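/- Let $N\ge 2$ and let $\mathcal R$ be the star network with branches $R_1,\dots,R_N$, each identified with $(0,\infty)$ and joined at $0$; put $\|f\|_{L^1(\mathcal R)}=\sum_{k}\|f_k\|_{L^1(R_k)}$ and $\|f\|_{L^\infty(\mathcal R)}=\max_k\|f_k\|_{L^\infty(R_k)}$. On the Hilbert space $L^2(\mathcal R)=\prod_{k=1}^N L^2(R_k)$ of complex-valued functions, let $H_0$ be the free Kirchhoff Laplacian $H_0(u_k)_k=(-u_k'')_k$ with domain $$\mathcal D(H_0)=\Big\{(u_k)\in\prod_{k=1}^N H^2(R_k):\ u_i(0)=u_k(0)\ \text{for all } i,k,\ \ \sum_{k=1}^N u_k'(0^+)=0\Big\}.$$ Theorem (dispersive estimate). The operator $iH_0$ is the infinitesimal generator of a unique strongly continuous one-parameter unitary group $(e^{itH_0})_{t\in\mathbb R}$ on $L^2(\mathcal R)$, and there is a constant $C>0$, which can be chosen independently of $N$, such that for all $t\neq 0$ $$\|e^{itH_0}\|_{L^1(\mathcal R)\to L^\infty(\mathcal R)}\le C\,|t|^{-1/2},$$ that is, $\|e^{itH_0}f\|_{L^\infty(\mathcal R)}\le C|t|^{-1/2}\|f\|_{L^1(\mathcal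 R)}$ for all $f\in L^1(\mathcal R)\cap L^2(\mathcal R)$. -/

import Mathlib

open MeasureTheory Set
open scoped ENNReal ContDiff

namespace StarNetwork

noncomputable section

/-- Lebesgue measure on a branch `R_k`, identified with `(0, ∞)`. -/
abbrev branchMeasure : Measure ℝ := volume.restrict (Ioi (0 : ℝ))

/-- `L²(R_k) = L²(0, ∞)`, complex valued. -/
abbrev BranchL2 : Type := Lp ℂ 2 branchMeasure

/-- The Hilbert space `∏_{k=1}^N L²(R_k)` with inner product `∑_k (u_k, v_k)_{L²(R_k)}`. -/
abbrev NetworkL2 (N : ℕ) : Type := PiLp 2 (fun _ : Fin N => BranchL2)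

/-- `v` is the weak (distributional) derivative of `u` on `(0, ∞)`. -/
def HasWeakDeriv (u v : BranchL2) : Prop :=
  ∀ φ : ℝ → ℝ, ContDiff ℝ ∞ φ → HasCompactSupport φ → tsupport φ ⊆ Ioi (0 : ℝ) →
    ∫ x in Ioi (0 : ℝ), deriv φ x • u x = -∫ x in Ioi (0 : ℝ), φ x • v x

/-- Membership in the Sobolev space `H²(0, ∞)`. -/
def MemH2 (u : BranchL2) : Prop :=
  ∃ v w : BranchL2, HasWeakDeriv u v ∧ HasWeakDeriv v w

/-- The transmission conditions at the vertex: `(u_k)` has a representative `(g_k)` in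
`∏ C¹([0, ∞))` with `g_i(0) = g_k(0)` for all `i, k` and `∑_k g_k'(0⁺) = 0`. -/
def SatisfiesKirchhoff {N : ℕ} (u : NetworkL2 N) : Prop :=
  ∃ g : Fin N → ℝ → ℂ,
    (∀ k, u k =ᵐ[branchMeasure] g k) ∧
    (∀ k, ContDiffOn ℝ 1 (g k) (Ici (0 : ℝ))) ∧
    (∀ i k, g i 0 = g k 0) ∧
    ∑ k, derivWithin (g k) (Ici (0 : ℝ)) 0 = 0

theorem integrable_test_smul {φ : ℝ → ℝ} (hφ : Continuous φ) (hc : HasCompactSupport φ)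
    (u : BranchL2) : Integrable (fun x => φ x • u x) branchMeasure := by
  have hφ2 : MemLp φ 2 branchMeasure := (hφ.memLp_of_hasCompactSupport hc)
  have h : MemLp (fun x => φ x • u x) 1 branchMeasure := (Lp.memLp u).smul hφ2
  exact memLp_one_iff_integrable.1 h

theorem HasWeakDeriv.add {u v u' v' : BranchL2} (h : HasWeakDeriv u v)
    (h' : HasWeakDeriv u' v') : HasWeakDeriv (u + u') (v + v') := by
  intro φ hφ hc hs
  have hd : Continuous (deriv φ) := hφ.continuous_deriv (by simp)
  have e1 : ∫ x in Ioi (0 : ℝ), deriv φ x • (u + u' : BranchL2) x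
      = ∫ x in Ioi (0 : ℝ), (deriv φ x • u x + deriv φ x • u' x) := by
    refine integral_congr_ae ?_
    filter_upwards [Lp.coeFn_add u u'] with x hx
    rw [hx, Pi.add_apply, smul_add]
  have e2 : ∫ x in Ioi (0 : ℝ), φ x • (v + v' : BranchL2) x
      = ∫ x in Ioi (0 : ℝ), (φ x • v x + φ x • v' x) := by
    refine integral_congr_ae ?_
    filter_upwards [Lp.coeFn_add v v'] with x hx
    rw [hx, Pi.add_apply, smul_add]
  rw [e1, e2, integral_add (integrable_test_smul hd hc.deriv u)
    (integrable_test_smul hd hc.deriv u'),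
    integral_add (integrable_test_smul hφ.continuous hc v)
    (integrable_test_smul hφ.continuous hc v'), h φ hφ hc hs, h' φ hφ hc hs]
  ring

theorem HasWeakDeriv.smul {u v : BranchL2} (c : ℂ) (h : HasWeakDeriv u v) :
    HasWeakDeriv (c • u) (c • v) := by
  intro φ hφ hc hs
  have e1 : ∫ x in Ioi (0 : ℝ), deriv φ x • (c • u : BranchL2) x
      = ∫ x in Ioi (0 : ℝ), c • (deriv φ x • u x) := by
    refine integral_congr_ae ?_
    filter_upwards [Lp.coeFn_smul c u] with x hx
    rw [hx, Pi.smul_apply, smul_comm]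
  have e2 : ∫ x in Ioi (0 : ℝ), φ x • (c • v : BranchL2) x
      = ∫ x in Ioi (0 : ℝ), c • (φ x • v x) := by
    refine integral_congr_ae ?_
    filter_upwards [Lp.coeFn_smul c v] with x hx
    rw [hx, Pi.smul_apply, smul_comm]
  rw [e1, e2, integral_smul, integral_smul, h φ hφ hc hs, smul_neg]

theorem hasWeakDeriv_zero : HasWeakDeriv 0 0 := by
  have h0 : ∀ ψ : ℝ → ℝ, ∫ x in Ioi (0 : ℝ), ψ x • (0 : BranchL2) x = 0 := by
    intro ψ
    rw [integral_eq_zero_of_ae]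
    filter_upwards [Lp.coeFn_zero ℂ 2 branchMeasure] with x hx
    rw [hx]; simp
  intro φ _ _ _
  rw [h0, h0, neg_zero]

theorem HasWeakDeriv.unique {u v w : BranchL2} (h : HasWeakDeriv u v)
    (h' : HasWeakDeriv u w) : v = w := by
  have key : ∀ᵐ x ∂(volume : Measure ℝ), x ∈ Ioi (0 : ℝ) → (v - w : BranchL2) x = 0 := by
    refine isOpen_Ioi.ae_eq_zero_of_integral_contDiff_smul_eq_zero ?_ ?_
    · rw [locallyIntegrableOn_iff (isOpen_Ioi.isLocallyClosed)]
      intro K hK hKc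
      have hm := (Lp.memLp (v - w)).mono_measure (Measure.restrict_mono hK le_rfl)
      have : IsFiniteMeasure (volume.restrict K) := ⟨by simpa using hKc.measure_lt_top⟩
      exact hm.integrable (by norm_num)
    · intro φ hφ hc hs
      have hi : ∫ x in Ioi (0 : ℝ), φ x • (v - w : BranchL2) x = 0 := by
        have e : ∫ x in Ioi (0 : ℝ), φ x • (v - w : BranchL2) x
            = ∫ x in Ioi (0 : ℝ), (φ x • v x - φ x • w x) := by
          refine integral_congr_ae ?_
          filter_upwards [Lp.coeFn_sub v w] with x hx
          rw [hx, Pi.sub_apply, smul_sub]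
        rw [e, integral_sub (integrable_test_smul hφ.continuous hc v)
          (integrable_test_smul hφ.continuous hc w), sub_eq_zero]
        exact neg_injective ((h φ hφ hc hs).symm.trans (h' φ hφ hc hs))
      rw [← hi, setIntegral_eq_integral_of_forall_compl_eq_zero]
      intro x hx
      rw [image_eq_zero_of_notMem_tsupport (fun hx' => hx (hs hx')), zero_smul]
  refine sub_eq_zero.mp (Lp.ext ?_)
  have key' := (ae_restrict_iff' (μ := (volume : Measure ℝ)) (measurableSet_Ioi (a := (0 : ℝ)))).2 key
  filter_upwards [key', Lp.coeFn_zero ℂ 2 branchMeasure] with x hx hx0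
  rw [hx, hx0, Pi.zero_apply]

/-- `D(H₀)`: the `(u_k) ∈ ∏ H²(R_k)` satisfying the transmission conditions. -/
def kirchhoffDomain (N : ℕ) : Submodule ℂ (NetworkL2 N) where
  carrier := {u | (∀ k, MemH2 (u k)) ∧ SatisfiesKirchhoff u}
  zero_mem' := by
    refine ⟨fun k => ⟨0, 0, hasWeakDeriv_zero, hasWeakDeriv_zero⟩,
      fun _ _ => 0, fun k => Lp.coeFn_zero ℂ 2 branchMeasure, fun k => contDiffOn_const,
      fun _ _ => rfl, by simp⟩
  add_mem' := by
    rintro u u' ⟨hu, g, hg, hgd, hg0, hgs⟩ ⟨hu', g', hg', hgd', hg0', hgs'⟩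
    refine ⟨fun k => ?_, fun k => g k + g' k, fun k => ?_, fun k => (hgd k).add (hgd' k),
      fun i k => ?_, ?_⟩
    · obtain ⟨v, w, h1, h2⟩ := hu k
      obtain ⟨v', w', h1', h2'⟩ := hu' k
      exact ⟨v + v', w + w', h1.add h1', h2.add h2'⟩
    · filter_upwards [Lp.coeFn_add (u k) (u' k), hg k, hg' k] with x h1 h2 h3
      rw [PiLp.add_apply, h1, Pi.add_apply, Pi.add_apply, h2, h3]
    · simp only [Pi.add_apply]
      rw [hg0 i k, hg0' i k]
    · have hd : ∀ k, derivWithin (g k + g' k) (Ici (0 : ℝ)) 0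
          = derivWithin (g k) (Ici (0 : ℝ)) 0 + derivWithin (g' k) (Ici (0 : ℝ)) 0 := fun k =>
        derivWithin_add ((hgd k).differentiableOn (by simp) 0 self_mem_Ici)
          ((hgd' k).differentiableOn (by simp) 0 self_mem_Ici)
      simp only [hd, Finset.sum_add_distrib, hgs, hgs', add_zero]
  smul_mem' := by
    rintro c u ⟨hu, g, hg, hgd, hg0, hgs⟩
    refine ⟨fun k => ?_, fun k => c • g k, fun k => ?_, fun k => (hgd k).const_smul c,
      fun i k => ?_, ?_⟩
    · obtain ⟨v, w, h1, h2⟩ := hu k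
      exact ⟨c • v, c • w, h1.smul c, h2.smul c⟩
    · filter_upwards [Lp.coeFn_smul c (u k), hg k] with x h1 h2
      rw [PiLp.smul_apply, h1, Pi.smul_apply, Pi.smul_apply, h2]
    · simp only [Pi.smul_apply]
      rw [hg0 i k]
    · have hd : ∀ k, derivWithin (c • g k) (Ici (0 : ℝ)) 0
          = c • derivWithin (g k) (Ici (0 : ℝ)) 0 := fun k =>
        derivWithin_const_smul c ((hgd k).differentiableOn (by simp) 0 self_mem_Ici)
      simp only [hd, ← Finset.smul_sum, hgs, smul_zero]

/-- The second weak derivative of an element of `H²(0, ∞)`. -/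
def secondDeriv (u : BranchL2) (hu : MemH2 u) : BranchL2 := hu.choose_spec.choose

theorem secondDeriv_eq {u v w : BranchL2} (hu : MemH2 u) (h : HasWeakDeriv u v)
    (h' : HasWeakDeriv v w) : secondDeriv u hu = w := by
  have hs := hu.choose_spec.choose_spec
  have e : hu.choose = v := hs.1.unique h
  have h2 : HasWeakDeriv v (secondDeriv u hu) := e ▸ hs.2
  exact h2.unique h'

/-- The free operator `H₀ (u_k) = (-u_k'')` with domain `D(H₀)`, as an unbounded operator. -/
def freeKirchhoff (N : ℕ) : NetworkL2 N →ₗ.[ℂ] NetworkL2 N where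
  domain := kirchhoffDomain N
  toFun :=
    { toFun := fun u => WithLp.toLp 2 (fun k => -secondDeriv (u.1 k) (u.2.1 k))
      map_add' := by
        intro u u'
        ext1 k
        obtain ⟨v, w, h1, h2⟩ := u.2.1 k
        obtain ⟨v', w', h1', h2'⟩ := u'.2.1 k
        simp only [PiLp.add_apply]
        rw [secondDeriv_eq (u.2.1 k) h1 h2, secondDeriv_eq (u'.2.1 k) h1' h2',
          secondDeriv_eq ((u + u').2.1 k) (h1.add h1') (h2.add h2'), neg_add]
      map_smul' := by
        intro c u
        ext1 k
        obtain ⟨v, w, h1, h2⟩ := u.2.1 k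
        simp only [PiLp.smul_apply, RingHom.id_apply]
        rw [secondDeriv_eq (u.2.1 k) h1 h2,
          secondDeriv_eq ((c • u).2.1 k) (h1.smul c) (h2.smul c), smul_neg] }

/-- `U t = e^{itA}`: `U` is the strongly continuous one-parameter unitary group whose
infinitesimal generator is exactly `i A`, that is, `D(A)` consists of those `f` for which
`t ↦ U t f` is differentiable at `0`, and this derivative is `i A f`. -/
structure IsUnitaryGroupOf {E : Type*} [NormedAddCommGroup E] [InnerProductSpace ℂ E]
    (A : E →ₗ.[ℂ] E) (U : ℝ → E ≃ₗᵢ[ℂ] E) : Prop where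
  map_add : ∀ s t f, U (s + t) f = U s (U t f)
  continuous : ∀ f, Continuous fun t => U t f
  generator : ∀ f g : E, (f, g) ∈ A.graph ↔ HasDerivAt (fun t => U t f) (Complex.I • g) 0

/-- `‖f‖_{L¹(R)} = ∑_k ∫_{R_k} |f_k|`, with values in `[0, ∞]`. -/
def l1Norm {N : ℕ} (f : NetworkL2 N) : ℝ≥0∞ := ∑ k, eLpNorm (f k) 1 branchMeasure

/-- `‖f‖_{L^∞(R)} = max_k ess sup_{R_k} |f_k|`, with values in `[0, ∞]`. -/
def linftyNorm {N : ℕ} (f : NetworkL2 N) : ℝ≥0∞ := ⨆ k, eLpNorm (f k) ⊤ branchMeasure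

/-- The norm `‖T‖_{L¹(R) → L^∞(R)}` in `[0, ∞]` of an operator `T` given on `L²(R)`: the least
`K` with `‖T f‖_∞ ≤ K ‖f‖_1` for all `f ∈ L¹(R) ∩ L²(R)`. -/
def l1ToLinftyNorm {N : ℕ} (T : NetworkL2 N → NetworkL2 N) : ℝ≥0∞ :=
  sInf {K : ℝ≥0∞ | ∀ f : NetworkL2 N, l1Norm f < ⊤ → linftyNorm (T f) ≤ K * l1Norm f}

end

end StarNetwork

namespace StarNetwork

noncomputable section

open Filter Topology FourierTransform SchwartzMap

/-! The star is unfolded into `N` copies of the line. Let `S` be the vertex scattering map, `(Su)_k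
= (2/N) ∑_j u_j - u_k`, a unitary involution, and let `unfold k u` be `u_k(x)` for `x > 0` and
`(Su)_k(-x)` for `x < 0`. For branches that are `C¹` up to the vertex, the Kirchhoff conditions say
exactly that every unfolded function is `C¹` across `0`: continuity at the vertex matches the
values, vanishing total flux matches the derivatives. Hence `H₀` acts as `-d²/dx²` on each line.

The group `e^{-it d²/dx²}` on the line is the Fourier multiplier `exp(it(2πξ)²)`. Its symbol is
even, so it commutes with reflection and preserves the linear relations that characterise unfoldings
(`unfold_networkGroupFun`). Evolving the unfoldings and restricting to the half-line therefore gives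
a unitary group on the network.

Its generator is identified on the Fourier side, by the relation `(2πξ)² 𝓕F = 𝓕G`
(`hasDerivAt_lineGroup_iff`). Elements of `D(H₀)` satisfy it because the boundary terms of two
integrations by parts cancel (`symbol_mul_fourier_glue`). Conversely it yields weak derivatives and
a `C¹` representative (`exists_deriv_of_symbol_mul_fourier`), from which the vertex conditions are
read off at `0` (`satisfiesKirchhoff_of_unfold`).

Uniqueness is abstract: two groups with the same generator agree on its domain, which is dense.

For the dispersive bound, the regularised kernel on the line is a complex Gaussian of modulus at
most `|t|^{-1/2}` (`eLpNorm_top_lineGroup_le`). Unfolding costs a factor at most `3` in `L¹` since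
`2/N ≤ 1`, so `C = 3` serves every `N`. -/

/-- `L²(ℝ)`, complex valued. -/
abbrev LineL2 : Type := Lp ℂ 2 (volume : Measure ℝ)

/-! ### The `L²` Fourier transform, tested against Schwartz functions -/

/-- The `L²` transform agrees with that of tempered distributions, which is defined by duality. The
pairing is bilinear, so no conjugate appears. -/
theorem integral_mul_fourier (φ : 𝓢(ℝ, ℂ)) (F : LineL2) :
    ∫ x, φ x * (𝓕 F : LineL2) x = ∫ x, 𝓕 φ x * F x := by
  have h := congrArg (fun T => T φ) (Lp.fourier_toTemperedDistribution_eq F)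
  simpa [TemperedDistribution.fourier_apply] using h.symm

theorem integral_mul_fourierInv (φ : 𝓢(ℝ, ℂ)) (F : LineL2) :
    ∫ x, φ x * (𝓕⁻ F : LineL2) x = ∫ x, 𝓕⁻ φ x * F x := by
  have h := congrArg (fun T => T φ) (Lp.fourierInv_toTemperedDistribution_eq F)
  simpa [TemperedDistribution.fourierInv_apply] using h.symm

theorem ae_eq_of_forall_schwartz {f g : ℝ → ℂ} (hf : LocallyIntegrable f)
    (hg : LocallyIntegrable g) (h : ∀ φ : 𝓢(ℝ, ℂ), ∫ x, φ x * f x = ∫ x, φ x * g x) :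
    f =ᵐ[volume] g := by
  refine ae_eq_of_integral_contDiff_smul_eq hf hg fun φ hφ hc => ?_
  have hc' : HasCompactSupport (fun x => (φ x : ℂ)) := hc.comp_left (g := Complex.ofReal) rfl
  exact h (hc'.toSchwartzMap (Complex.ofRealCLM.contDiff.comp hφ))

theorem locallyIntegrable_lp (F : LineL2) : LocallyIntegrable F :=
  (Lp.memLp F).locallyIntegrable (by norm_num)

theorem integral_mul_fourier_fun {f g : ℝ → ℂ} (hf : Integrable f) (hg : Integrable g) :
    ∫ x, f x * 𝓕 g x = ∫ x, 𝓕 f x * g x := by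
  have h := VectorFourier.integral_fourierIntegral_smul_eq_flip (L := innerₗ ℝ)
    Real.continuous_fourierChar continuous_inner hf hg
  rw [flip_innerₗ] at h
  exact h.symm

theorem integral_mul_fourierInv_fun {f g : ℝ → ℂ} (hf : Integrable f) (hg : Integrable g) :
    ∫ x, f x * 𝓕⁻ g x = ∫ x, 𝓕⁻ f x * g x := by
  have h := integral_mul_fourier_fun hf.comp_neg hg
  rw [← integral_neg_eq_self] at h
  simp only [neg_neg] at h
  simp only [Real.fourierInv_eq_fourier_neg]
  rw [h]
  congr! 3 with x
  rw [← Real.fourierInv_eq_fourier_comp_neg, Real.fourierInv_eq_fourier_neg]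

theorem locallyIntegrable_fourier {f : ℝ → ℂ} (hf : Integrable f) : LocallyIntegrable (𝓕 f) :=
  (VectorFourier.fourierIntegral_continuous Real.continuous_fourierChar
    (L := innerₗ ℝ) continuous_inner hf).locallyIntegrable

/-- On `L¹ ∩ L²` the `L²` Fourier transform is the Fourier integral. -/
theorem fourier_ae_eq {F : LineL2} (hF : Integrable F) :
    (𝓕 F : LineL2) =ᵐ[volume] 𝓕 (F : ℝ → ℂ) := by
  refine ae_eq_of_forall_schwartz (locallyIntegrable_lp _) (locallyIntegrable_fourier hF)
    fun φ => ?_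
  rw [integral_mul_fourier, integral_mul_fourier_fun φ.integrable hF, SchwartzMap.fourier_coe]

theorem fourierInv_ae_eq {F : LineL2} (hF : Integrable F) :
    (𝓕⁻ F : LineL2) =ᵐ[volume] 𝓕⁻ (F : ℝ → ℂ) := by
  refine ae_eq_of_forall_schwartz (locallyIntegrable_lp _) ?_ fun φ => ?_
  · rw [Real.fourierInv_eq_fourier_comp_neg]
    exact locallyIntegrable_fourier hF.comp_neg
  rw [integral_mul_fourierInv, integral_mul_fourierInv_fun φ.integrable hF,
    SchwartzMap.fourierInv_coe]

/-! ### The multiplier group on the Fourier side -/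

/-- The symbol of `-d²/dx²`. -/
def symbol (ξ : ℝ) : ℝ := (2 * Real.pi * ξ) ^ 2

/-- The multiplier of `e^{-it d²/dx²}`. -/
def phase (t ξ : ℝ) : ℂ := Complex.exp ((t * symbol ξ : ℝ) * Complex.I)

theorem norm_phase (t ξ : ℝ) : ‖phase t ξ‖ = 1 := Complex.norm_exp_ofReal_mul_I _

theorem phase_add (s t ξ : ℝ) : phase (s + t) ξ = phase s ξ * phase t ξ := by
  rw [phase, phase, phase, ← Complex.exp_add]
  push_cast
  ring_nf

theorem phase_zero (ξ : ℝ) : phase 0 ξ = 1 := by simp [phase]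

theorem continuous_phase (t : ℝ) : Continuous (phase t) := by
  unfold phase symbol; fun_prop

theorem continuous_phase_left (ξ : ℝ) : Continuous fun t => phase t ξ := by
  unfold phase symbol; fun_prop

theorem hasDerivAt_phase (ξ : ℝ) :
    HasDerivAt (fun t => phase t ξ) (symbol ξ * Complex.I) 0 := by
  have h : HasDerivAt (fun t : ℝ => ((t * symbol ξ : ℝ) * Complex.I : ℂ)) (symbol ξ * Complex.I) 0 := by
    have := ((hasDerivAt_id (0 : ℝ)).mul_const (symbol ξ)).ofReal_comp.mul_const Complex.I
    simpa using this
  simpa [phase] using h.cexp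

theorem norm_phase_sub_one_le (t ξ : ℝ) : ‖phase t ξ - 1‖ ≤ |t| * |symbol ξ| := by
  have := Real.norm_exp_I_mul_ofReal_sub_one_le (x := t * symbol ξ)
  rw [phase, mul_comm]
  simpa [abs_mul] using this

theorem memLp_phase_mul (t : ℝ) (F : LineL2) : MemLp (fun ξ => phase t ξ * F ξ) 2 volume := by
  refine (Lp.memLp F).congr_norm
    ((continuous_phase t).aestronglyMeasurable.mul (Lp.aestronglyMeasurable F)) ?_
  filter_upwards with ξ
  rw [norm_mul, norm_phase, one_mul]

/-- Multiplication by `phase t` on `L²(ℝ)`. -/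
def phaseMul (t : ℝ) : LineL2 →ₗᵢ[ℂ] LineL2 where
  toFun F := (memLp_phase_mul t F).toLp _
  map_add' F G := by
    refine Lp.ext ?_
    filter_upwards [(memLp_phase_mul t (F + G)).coeFn_toLp, (memLp_phase_mul t F).coeFn_toLp,
      (memLp_phase_mul t G).coeFn_toLp, Lp.coeFn_add F G,
      Lp.coeFn_add ((memLp_phase_mul t F).toLp _) ((memLp_phase_mul t G).toLp _)]
      with x h1 h2 h3 h4 h5
    rw [h1, h5, Pi.add_apply, h2, h3, h4, Pi.add_apply, mul_add]
  map_smul' c F := by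
    refine Lp.ext ?_
    filter_upwards [(memLp_phase_mul t (c • F)).coeFn_toLp, (memLp_phase_mul t F).coeFn_toLp,
      Lp.coeFn_smul c F, Lp.coeFn_smul c ((memLp_phase_mul t F).toLp _)]
      with x h1 h2 h3 h4
    rw [h1, RingHom.id_apply, h4, Pi.smul_apply, h2, h3, Pi.smul_apply, smul_eq_mul, smul_eq_mul,
      mul_left_comm]
  norm_map' F := by
    change ‖(memLp_phase_mul t F).toLp _‖ = ‖F‖
    rw [Lp.norm_toLp, Lp.norm_def]
    congr 1
    refine eLpNorm_congr_norm_ae ?_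
    filter_upwards with ξ
    rw [norm_mul, norm_phase, one_mul]

theorem coeFn_phaseMul (t : ℝ) (F : LineL2) :
    phaseMul t F =ᵐ[volume] fun ξ => phase t ξ * F ξ :=
  (memLp_phase_mul t F).coeFn_toLp

theorem phaseMul_add (s t : ℝ) (F : LineL2) :
    phaseMul (s + t) F = phaseMul s (phaseMul t F) := by
  refine Lp.ext ?_
  filter_upwards [coeFn_phaseMul (s + t) F, coeFn_phaseMul s (phaseMul t F), coeFn_phaseMul t F]
    with ξ h1 h2 h3
  rw [h1, h2, h3, phase_add, mul_assoc]

theorem phaseMul_zero (F : LineL2) : phaseMul 0 F = F := by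
  refine Lp.ext ?_
  filter_upwards [coeFn_phaseMul 0 F] with ξ h1
  rw [h1, phase_zero, one_mul]

/-- Dominated convergence in `L²`. -/
theorem tendsto_lp_of_dominated {ι : Type*} {l : Filter ι} [l.IsCountablyGenerated]
    {H : ι → LineL2} {G : LineL2} {b : ℝ → ℝ} (hb : MemLp b 2 volume)
    (hbound : ∀ᶠ i in l, ∀ᵐ x, ‖H i x - G x‖ ≤ b x)
    (hlim : ∀ᵐ x, Tendsto (fun i => H i x) l (𝓝 (G x))) : Tendsto H l (𝓝 G) := by
  rw [Lp.tendsto_Lp_iff_tendsto_eLpNorm']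
  have hI : ∫⁻ x, ‖b x‖ₑ ^ (2 : ℝ) ≠ ⊤ := by
    have := lintegral_rpow_enorm_lt_top_of_eLpNorm_lt_top (by norm_num) (by norm_num) hb.2
    simpa using this.ne
  have key : Tendsto (fun i => ∫⁻ x, ‖(H i - G : ℝ → ℂ) x‖ₑ ^ (2 : ℝ)) l (𝓝 0) := by
    have h0 : (0 : ℝ≥0∞) = ∫⁻ x : ℝ, 0 := by simp
    rw [h0]
    refine tendsto_lintegral_filter_of_dominated_convergence (fun x => ‖b x‖ₑ ^ (2 : ℝ)) ?_ ?_ hI ?_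
    · filter_upwards with i
      exact (((Lp.stronglyMeasurable (H i)).sub
        (Lp.stronglyMeasurable G)).enorm.pow_const _)
    · filter_upwards [hbound] with i hi
      filter_upwards [hi] with x hx
      refine ENNReal.rpow_le_rpow (enorm_le_iff_norm_le.2 ?_) (by norm_num)
      rw [Pi.sub_apply, Real.norm_eq_abs]
      exact hx.trans (le_abs_self _)
    · filter_upwards [hlim] with x hx
      have h1 : Tendsto (fun i => ‖(H i - G : ℝ → ℂ) x‖ₑ) l (𝓝 0) := by
        have := (hx.sub_const (G x)).enorm
        simpa using this
      have := (ENNReal.continuous_rpow_const (y := (2 : ℝ))).tendsto 0 |>.comp h1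
      simpa [Function.comp_def] using this
  have h2 : ∀ i, eLpNorm (H i - G : ℝ → ℂ) 2 volume
      = (∫⁻ x, ‖(H i - G : ℝ → ℂ) x‖ₑ ^ (2 : ℝ)) ^ (1 / (2 : ℝ)) := fun i => by
    rw [eLpNorm_eq_lintegral_rpow_enorm_toReal (by norm_num) (by norm_num)]
    simp
  simp only [h2]
  have := (ENNReal.continuous_rpow_const (y := 1 / (2 : ℝ))).tendsto 0 |>.comp key
  simpa [Function.comp_def] using this

theorem tendsto_phaseMul_zero (F : LineL2) : Tendsto (fun t => phaseMul t F) (𝓝 0) (𝓝 F) := by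
  -- The exceptional null set in `coeFn_phaseMul` depends on `t`; along a sequence only countably
  -- many occur.
  rw [tendsto_iff_seq_tendsto]
  intro u hu
  refine tendsto_lp_of_dominated (b := fun x => 2 * ‖F x‖) ((Lp.memLp F).norm.const_mul 2) ?_ ?_
  · filter_upwards with n
    filter_upwards [coeFn_phaseMul (u n) F] with x hx
    rw [Function.comp_apply, hx]
    refine (norm_sub_le _ _).trans ?_
    rw [norm_mul, norm_phase]
    linarith
  · have : ∀ᵐ x, ∀ n, phaseMul (u n) F x = phase (u n) x * F x :=
      ae_all_iff.2 fun n => coeFn_phaseMul (u n) F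
    filter_upwards [this] with x hx
    simp only [Function.comp_apply, hx]
    have := (((continuous_phase_left x).tendsto 0).comp hu).mul_const (F x)
    simpa [phase_zero] using this

/-- The generator of a multiplier group is multiplication by the symbol. If the difference quotients
converge in `L²`, a subsequence converges almost everywhere and its limit is known pointwise.
Conversely `|e^{is} - 1| ≤ |s|` bounds the quotients by `|G|`, and dominated convergence applies. -/
theorem hasDerivAt_phaseMul_iff (F G : LineL2) :
    HasDerivAt (fun t => phaseMul t F) (Complex.I • G) 0 ↔
      ∀ᵐ ξ, (symbol ξ : ℂ) * F ξ = G ξ := by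
  have hslope : ∀ t : ℝ, ∀ᵐ ξ, (slope (fun t => phaseMul t F) 0 t : LineL2) ξ
      = (t : ℂ)⁻¹ * ((phase t ξ - 1) * F ξ) := by
    intro t
    have e : slope (fun t => phaseMul t F) 0 t = (t : ℂ)⁻¹ • (phaseMul t F - F) := by
      rw [slope_def_module, phaseMul_zero, sub_zero, ← Complex.ofReal_inv]
      exact (Complex.coe_smul _ _).symm
    rw [e]
    filter_upwards [Lp.coeFn_smul (t : ℂ)⁻¹ (phaseMul t F - F), Lp.coeFn_sub (phaseMul t F) F,
      coeFn_phaseMul t F] with ξ h1 h2 h3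
    rw [h1, Pi.smul_apply, h2, Pi.sub_apply, h3, smul_eq_mul]
    ring
  have hpt : ∀ (u : ℕ → ℝ), Tendsto u atTop (𝓝[≠] 0) → ∀ ξ,
      Tendsto (fun n => ((u n : ℝ) : ℂ)⁻¹ * ((phase (u n) ξ - 1) * F ξ)) atTop
        (𝓝 (Complex.I * (symbol ξ * F ξ))) := by
    intro u hu ξ
    have := ((hasDerivAt_iff_tendsto_slope.1 (hasDerivAt_phase ξ)).comp hu).mul_const (F ξ)
    convert this using 2
    · simp only [Function.comp_apply, slope_def_module, phase_zero, sub_zero]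
      rw [← Complex.coe_smul, Complex.ofReal_inv, smul_eq_mul, mul_assoc]
    · ring
  rw [hasDerivAt_iff_tendsto_slope]
  constructor
  · intro h
    obtain ⟨u, hu⟩ : ∃ u : ℕ → ℝ, Tendsto u atTop (𝓝[≠] 0) := exists_seq_tendsto _
    have h1 := h.comp hu
    have h2 := (tendstoInMeasure_of_tendsto_Lp h1).exists_seq_tendsto_ae
    obtain ⟨ns, hns, hae⟩ := h2
    have hall : ∀ᵐ ξ, ∀ n, (slope (fun t => phaseMul t F) 0 (u n) : LineL2) ξ
      = ((u n : ℝ) : ℂ)⁻¹ * ((phase (u n) ξ - 1) * F ξ) := ae_all_iff.2 fun n => hslope (u n)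
    filter_upwards [hae, hall, Lp.coeFn_smul Complex.I G] with ξ h3 h4 h5
    have h6 := (hpt u hu ξ).comp hns.tendsto_atTop
    have h7 := tendsto_nhds_unique (h3.congr fun n => h4 (ns n)) h6
    rw [h5, Pi.smul_apply, smul_eq_mul] at h7
    exact (mul_left_cancel₀ Complex.I_ne_zero h7).symm
  · intro h
    rw [tendsto_iff_seq_tendsto]
    intro u hu
    refine tendsto_lp_of_dominated (b := fun x => 2 * ‖G x‖) ((Lp.memLp G).norm.const_mul 2) ?_ ?_
    · filter_upwards with n
      filter_upwards [hslope (u n), h, Lp.coeFn_smul Complex.I G] with x h1 h2 h3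
      rw [Function.comp_apply, h1, h3, Pi.smul_apply, smul_eq_mul]
      refine (norm_sub_le _ _).trans ?_
      rw [norm_mul Complex.I, Complex.norm_I, one_mul, two_mul]
      gcongr
      rw [← h2, norm_mul, norm_mul, norm_mul, norm_inv, Complex.norm_real, Complex.norm_real,
        Real.norm_eq_abs, Real.norm_eq_abs, ← mul_assoc]
      gcongr
      -- A sequence tending to `𝓝[≠] 0` may still take the value `0` finitely often; there the
      -- quotient is `0` because `0⁻¹ = 0`.
      by_cases h0 : u n = 0
      · simp [h0]
      · rw [inv_mul_le_iff₀ (abs_pos.2 h0)]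
        exact norm_phase_sub_one_le _ _
    · have hall : ∀ᵐ ξ, ∀ n, (slope (fun t => phaseMul t F) 0 (u n) : LineL2) ξ
        = ((u n : ℝ) : ℂ)⁻¹ * ((phase (u n) ξ - 1) * F ξ) := ae_all_iff.2 fun n => hslope (u n)
      filter_upwards [hall, h, Lp.coeFn_smul Complex.I G] with ξ h4 h5 h6
      rw [h6, Pi.smul_apply, smul_eq_mul, ← h5]
      exact (hpt u hu ξ).congr fun n => (h4 n).symm

/-! ### The free Schrödinger group on the line -/

theorem hasDerivAt_clm_apply {E F : Type*} [NormedAddCommGroup E] [NormedSpace ℂ E]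
    [NormedAddCommGroup F] [NormedSpace ℂ F] (L : E →L[ℂ] F) {f : ℝ → E} {f' : E} {t : ℝ}
    (h : HasDerivAt f f' t) : HasDerivAt (fun s => L (f s)) (L f') t :=
  (L.restrictScalars ℝ).hasFDerivAt.comp_hasDerivAt t h

/-- The group `e^{-it d²/dx²}` on `L²(ℝ)`. -/
def lineGroup (t : ℝ) : LineL2 →ₗᵢ[ℂ] LineL2 :=
  ((Lp.fourierTransformₗᵢ ℝ ℂ).symm.toLinearIsometry.comp (phaseMul t)).comp
    (Lp.fourierTransformₗᵢ ℝ ℂ).toLinearIsometry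

theorem lineGroup_apply (t : ℝ) (F : LineL2) : lineGroup t F = 𝓕⁻ (phaseMul t (𝓕 F)) := rfl

theorem lineGroup_add (s t : ℝ) (F : LineL2) :
    lineGroup (s + t) F = lineGroup s (lineGroup t F) := by
  rw [lineGroup_apply, lineGroup_apply s, lineGroup_apply t,
    fourier_fourierInv_eq (E := LineL2) (F := LineL2), phaseMul_add]

theorem lineGroup_zero (F : LineL2) : lineGroup 0 F = F := by
  rw [lineGroup_apply, phaseMul_zero]
  exact fourierInv_fourier_eq (E := LineL2) (F := LineL2) F

theorem continuous_lineGroup (F : LineL2) : Continuous fun t => lineGroup t F := by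
  rw [continuous_iff_continuousAt]
  intro t
  have h0 : Tendsto (fun s => lineGroup s F) (𝓝 0) (𝓝 F) := by
    have := ((Lp.fourierTransformₗᵢ ℝ ℂ).symm.continuous.tendsto _).comp
      (tendsto_phaseMul_zero (𝓕 F))
    change Tendsto (fun s => lineGroup s F) (𝓝 0) (𝓝 (𝓕⁻ (𝓕 F) : LineL2)) at this
    rwa [fourierInv_fourier_eq (E := LineL2) (F := LineL2)] at this
  have h1 : Tendsto (fun s => s - t) (𝓝 t) (𝓝 0) := by
    have := (continuous_sub_right t).tendsto t
    rwa [sub_self] at this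
  have h2 := ((lineGroup t).continuous.tendsto F).comp (h0.comp h1)
  refine h2.congr fun s => ?_
  rw [Function.comp_apply, Function.comp_apply, ← lineGroup_add, add_sub_cancel]

theorem hasDerivAt_lineGroup_iff (F G : LineL2) :
    HasDerivAt (fun t => lineGroup t F) (Complex.I • G) 0 ↔
      ∀ᵐ ξ, (symbol ξ : ℂ) * (𝓕 F : LineL2) ξ = (𝓕 G : LineL2) ξ := by
  rw [← hasDerivAt_phaseMul_iff]
  constructor
  · intro h
    have h1 := hasDerivAt_clm_apply (Lp.fourierTransformₗᵢ ℝ ℂ).toContinuousLinearEquiv.toContinuousLinearMap h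
    refine (h1.congr_deriv ((Lp.fourierTransformₗᵢ ℝ ℂ).map_smul _ _)).congr_of_eventuallyEq ?_
    filter_upwards with t
    exact (fourier_fourierInv_eq (E := LineL2) (F := LineL2) _).symm
  · intro h
    have h1 := hasDerivAt_clm_apply
      (Lp.fourierTransformₗᵢ ℝ ℂ).symm.toContinuousLinearEquiv.toContinuousLinearMap h
    refine h1.congr_deriv (((Lp.fourierTransformₗᵢ ℝ ℂ).symm.map_smul _ _).trans ?_)
    congr 1
    exact fourierInv_fourier_eq (E := LineL2) (F := LineL2) G

/-! ### Restriction, reflection and gluing of half-lines -/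

theorem lp_two_norm_sq {μ : Measure ℝ} (F : Lp ℂ 2 μ) : ‖F‖ ^ 2 = ∫ x, ‖F x‖ ^ 2 ∂μ := by
  have h1 : RCLike.re (inner ℂ F F) = ‖F‖ ^ 2 := inner_self_eq_norm_sq F
  rw [← h1, L2.inner_def, ← integral_re (L2.integrable_inner F F)]
  refine integral_congr_ae (Eventually.of_forall fun x => ?_)
  exact inner_self_eq_norm_sq (F x)

/-- Restriction of functions on the line to the half-line. -/
def restrictHalf : LineL2 →L[ℂ] BranchL2 := LpToLpRestrictCLM ℝ ℂ ℂ volume 2 (Ioi 0)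

theorem coeFn_restrictHalf (F : LineL2) : restrictHalf F =ᵐ[branchMeasure] F :=
  LpToLpRestrictCLM_coeFn ℂ (Ioi 0) F

/-- Reflection `F(x) ↦ F(-x)` on `L²(ℝ)`. -/
def reflect : LineL2 →ₗᵢ[ℂ] LineL2 :=
  Lp.compMeasurePreservingₗᵢ ℂ Neg.neg (Measure.measurePreserving_neg volume)

theorem coeFn_reflect (F : LineL2) : reflect F =ᵐ[volume] fun x => F (-x) :=
  Lp.coeFn_compMeasurePreserving F (Measure.measurePreserving_neg volume)

theorem ae_comp_neg {p : ℝ → Prop} (h : ∀ᵐ x, p x) : ∀ᵐ x, p (-x) :=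
  (Measure.measurePreserving_neg (volume : Measure ℝ)).quasiMeasurePreserving.ae h

theorem reflect_reflect (F : LineL2) : reflect (reflect F) = F := by
  refine Lp.ext ?_
  filter_upwards [coeFn_reflect (reflect F), ae_comp_neg (coeFn_reflect F)] with x h1 h2
  rw [h1, h2, neg_neg]

theorem memLp_indicator_branch (a : BranchL2) : MemLp ((Ioi (0 : ℝ)).indicator a) 2 volume :=
  (memLp_indicator_iff_restrict measurableSet_Ioi).2 (Lp.memLp a)

/-- Extension by zero from the half-line to the line, as a linear map. -/
def extendZeroₗ : BranchL2 →ₗ[ℂ] LineL2 where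
  toFun a := (memLp_indicator_branch a).toLp _
  map_add' a b := by
    refine Lp.ext ?_
    have hab := (ae_restrict_iff' (measurableSet_Ioi (a := (0 : ℝ)))).1 (Lp.coeFn_add a b)
    filter_upwards [(memLp_indicator_branch (a + b)).coeFn_toLp,
      (memLp_indicator_branch a).coeFn_toLp, (memLp_indicator_branch b).coeFn_toLp, hab,
      Lp.coeFn_add ((memLp_indicator_branch a).toLp _) ((memLp_indicator_branch b).toLp _)]
      with x h1 h2 h3 h4 h5
    rw [h1, h5, Pi.add_apply, h2, h3]
    by_cases hx : x ∈ Ioi (0 : ℝ)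
    · simp only [indicator_of_mem hx, h4 hx, Pi.add_apply]
    · simp only [indicator_of_notMem hx, add_zero]
  map_smul' c a := by
    refine Lp.ext ?_
    have hab := (ae_restrict_iff' (measurableSet_Ioi (a := (0 : ℝ)))).1 (Lp.coeFn_smul c a)
    filter_upwards [(memLp_indicator_branch (c • a)).coeFn_toLp,
      (memLp_indicator_branch a).coeFn_toLp, hab,
      Lp.coeFn_smul c ((memLp_indicator_branch a).toLp _)] with x h1 h2 h4 h5
    rw [h1, RingHom.id_apply, h5, Pi.smul_apply, h2]
    by_cases hx : x ∈ Ioi (0 : ℝ)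
    · simp only [indicator_of_mem hx, h4 hx, Pi.smul_apply]
    · simp only [indicator_of_notMem hx, smul_zero]

theorem coeFn_extendZeroₗ (a : BranchL2) :
    extendZeroₗ a =ᵐ[volume] (Ioi (0 : ℝ)).indicator a :=
  (memLp_indicator_branch a).coeFn_toLp

theorem norm_extendZeroₗ (a : BranchL2) : ‖extendZeroₗ a‖ = ‖a‖ := by
  change ‖(memLp_indicator_branch a).toLp _‖ = ‖a‖
  rw [Lp.norm_toLp, Lp.norm_def, eLpNorm_indicator_eq_eLpNorm_restrict measurableSet_Ioi]

/-- Extension by zero from the half-line to the line. -/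
def extendZero : BranchL2 →ₗᵢ[ℂ] LineL2 := ⟨extendZeroₗ, norm_extendZeroₗ⟩

theorem coeFn_extendZero (a : BranchL2) :
    extendZero a =ᵐ[volume] (Ioi (0 : ℝ)).indicator a := coeFn_extendZeroₗ a

theorem restrictHalf_extendZero (a : BranchL2) : restrictHalf (extendZero a) = a := by
  refine Lp.ext ?_
  filter_upwards [coeFn_restrictHalf (extendZero a), ae_restrict_of_ae (coeFn_extendZero a),
    ae_restrict_mem measurableSet_Ioi] with x h1 h2 h3
  rw [h1, h2, indicator_of_mem h3]

theorem restrictHalf_reflect_extendZero (a : BranchL2) :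
    restrictHalf (reflect (extendZero a)) = 0 := by
  refine Lp.ext ?_
  filter_upwards [coeFn_restrictHalf (reflect (extendZero a)),
    ae_restrict_of_ae (coeFn_reflect (extendZero a)),
    ae_restrict_of_ae (ae_comp_neg (coeFn_extendZero a)),
    ae_restrict_mem measurableSet_Ioi, Lp.coeFn_zero ℂ 2 branchMeasure] with x h1 h2 h3 h4 h5
  have h6 : -x ∉ Ioi (0 : ℝ) := by
    simp only [mem_Ioi] at h4 ⊢
    linarith
  rw [h1, h2, h3, h5, indicator_of_notMem h6, Pi.zero_apply]

theorem norm_sq_eq_restrictHalf_add (F : LineL2) :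
    ‖F‖ ^ 2 = ‖restrictHalf F‖ ^ 2 + ‖restrictHalf (reflect F)‖ ^ 2 := by
  have hi : Integrable (fun x => ‖F x‖ ^ 2) :=
    (Lp.memLp F).norm.integrable_sq
  rw [lp_two_norm_sq, lp_two_norm_sq, lp_two_norm_sq, ← integral_add_compl
    (measurableSet_Ioi (a := (0 : ℝ))) hi]
  congr 1
  · refine integral_congr_ae ?_
    filter_upwards [coeFn_restrictHalf F] with x h1
    rw [h1]
  · have := integral_comp_neg_Ioi (0 : ℝ) (fun x => ‖F x‖ ^ 2)
    rw [compl_Ioi]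
    rw [neg_zero] at this
    rw [← this]
    refine integral_congr_ae ?_
    filter_upwards [coeFn_restrictHalf (reflect F), ae_restrict_of_ae (coeFn_reflect F)] with x h1 h2
    rw [h1, h2]

/-- The function on the line equal to `a(x)` for `x > 0` and to `b(-x)` for `x < 0`. -/
def glue (a b : BranchL2) : LineL2 := extendZero a + reflect (extendZero b)

theorem reflect_glue (a b : BranchL2) : reflect (glue a b) = glue b a := by
  rw [glue, glue, map_add, reflect_reflect, add_comm]

theorem restrictHalf_glue (a b : BranchL2) : restrictHalf (glue a b) = a := by
  rw [glue, map_add, restrictHalf_extendZero, restrictHalf_reflect_extendZero, add_zero]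

/-- Both halves of the difference vanish, and by `norm_sq_eq_restrictHalf_add` the two halves carry
the whole norm. -/
theorem glue_restrictHalf (F : LineL2) :
    glue (restrictHalf F) (restrictHalf (reflect F)) = F := by
  have h := norm_sq_eq_restrictHalf_add (glue (restrictHalf F) (restrictHalf (reflect F)) - F)
  rw [map_sub, map_sub, map_sub, restrictHalf_glue, reflect_glue, restrictHalf_glue, sub_self,
    sub_self, norm_zero] at h
  exact sub_eq_zero.1 (norm_eq_zero.1 (by simpa using h))

theorem norm_sq_glue (a b : BranchL2) : ‖glue a b‖ ^ 2 = ‖a‖ ^ 2 + ‖b‖ ^ 2 := by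
  rw [norm_sq_eq_restrictHalf_add, reflect_glue, restrictHalf_glue, restrictHalf_glue]

theorem integral_mul_reflect (φ : ℝ → ℂ) (F : LineL2) :
    ∫ x, φ x * reflect F x = ∫ x, φ (-x) * F x := by
  rw [← integral_neg_eq_self (fun x => φ (-x) * F x)]
  refine integral_congr_ae ?_
  filter_upwards [coeFn_reflect F] with x h
  rw [h, neg_neg]

theorem fourier_reflect (F : LineL2) : (𝓕 (reflect F) : LineL2) = reflect (𝓕 F) := by
  refine Lp.ext (ae_eq_of_forall_schwartz (locallyIntegrable_lp _) (locallyIntegrable_lp _)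
    fun φ => ?_)
  let ψ : 𝓢(ℝ, ℂ) := compCLMOfContinuousLinearEquiv ℂ (ContinuousLinearEquiv.neg ℝ) φ
  have hψ : ∀ x, ψ x = φ (-x) := fun x => rfl
  have h1 : ∀ x, 𝓕 φ (-x) = 𝓕 ψ x := by
    intro x
    have := Real.fourierInv_eq_fourier_comp_neg (φ : ℝ → ℂ)
    rw [SchwartzMap.fourier_coe, SchwartzMap.fourier_coe, ← Real.fourierInv_eq_fourier_neg, this]
    rfl
  rw [integral_mul_fourier, integral_mul_reflect, integral_mul_reflect]
  simp only [h1, ← hψ]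
  rw [integral_mul_fourier]

theorem phaseMul_reflect (t : ℝ) (F : LineL2) :
    phaseMul t (reflect F) = reflect (phaseMul t F) := by
  refine Lp.ext ?_
  filter_upwards [coeFn_phaseMul t (reflect F), coeFn_reflect (phaseMul t F), coeFn_reflect F,
    ae_comp_neg (coeFn_phaseMul t F)] with x h1 h2 h3 h4
  rw [h1, h2, h3, h4]
  simp [phase, symbol]

/-- The symbol `(2πξ)²` is even and the Fourier transform commutes with reflection. -/
theorem lineGroup_reflect (t : ℝ) (F : LineL2) :
    lineGroup t (reflect F) = reflect (lineGroup t F) := by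
  apply (Lp.fourierTransformₗᵢ ℝ ℂ).injective
  change (𝓕 (lineGroup t (reflect F)) : LineL2) = 𝓕 (reflect (lineGroup t F))
  rw [fourier_reflect, lineGroup_apply, lineGroup_apply,
    fourier_fourierInv_eq (E := LineL2) (F := LineL2),
    fourier_fourierInv_eq (E := LineL2) (F := LineL2), fourier_reflect, phaseMul_reflect]

/-- On a glued function, integrals over the line split into two half-line integrals. -/
theorem integral_mul_glue {φ : ℝ → ℂ} (hφ : MemLp φ 2 volume) (a b : BranchL2) :
    ∫ x, φ x * glue a b x =
      (∫ x in Ioi (0 : ℝ), φ x * a x) + ∫ x in Ioi (0 : ℝ), φ (-x) * b x := by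
  have hE : ∀ (ψ : ℝ → ℂ) (c : BranchL2),
      ∫ x, ψ x * extendZero c x = ∫ x in Ioi (0 : ℝ), ψ x * c x := by
    intro ψ c
    rw [← integral_indicator measurableSet_Ioi]
    refine integral_congr_ae ?_
    filter_upwards [coeFn_extendZero c] with x h
    rw [h]
    by_cases hx : x ∈ Ioi (0 : ℝ)
    · simp only [indicator_of_mem hx]
    · simp only [indicator_of_notMem hx, mul_zero]
  have hI : ∀ F : LineL2, Integrable (fun x => φ x * F x) := fun F =>
    memLp_one_iff_integrable.1 ((Lp.memLp F).mul hφ)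
  rw [← hE, ← hE, ← integral_mul_reflect, ← integral_add (hI _) (hI _)]
  refine integral_congr_ae ?_
  filter_upwards [Lp.coeFn_add (extendZero a) (reflect (extendZero b))] with x h
  rw [glue, h, Pi.add_apply, mul_add]

/-! ### Integration by parts on the half-line -/

theorem integrable_mul_branch {ψ : ℝ → ℂ} (hψ : MemLp ψ 2 volume) (u : BranchL2) :
    Integrable (fun x => ψ x * u x) branchMeasure :=
  memLp_one_iff_integrable.1 ((Lp.memLp u).mul (hψ.restrict (Ioi 0)))

/-- Weak derivatives are defined with real test functions; a complex one is split into real and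
imaginary parts. -/
theorem HasWeakDeriv.integral_deriv_mul {u v : BranchL2} (h : HasWeakDeriv u v) {ψ : ℝ → ℂ}
    (hψ : ContDiff ℝ ∞ ψ) (hc : HasCompactSupport ψ) (hs : tsupport ψ ⊆ Ioi (0 : ℝ)) :
    ∫ x in Ioi (0 : ℝ), deriv ψ x * u x = -∫ x in Ioi (0 : ℝ), ψ x * v x := by
  have hd : ∀ x, HasDerivAt ψ (deriv ψ x) x := fun x =>
    (hψ.differentiable (by simp) x).hasDerivAt
  have part : ∀ L : ℂ →L[ℝ] ℝ,
      (∫ x in Ioi (0 : ℝ), L (deriv ψ x) • u x = -∫ x in Ioi (0 : ℝ), L (ψ x) • v x) ∧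
      Integrable (fun x => L (deriv ψ x) • u x) branchMeasure ∧
      Integrable (fun x => L (ψ x) • v x) branchMeasure := by
    intro L
    have hL : ContDiff ℝ ∞ (fun x => L (ψ x)) := L.contDiff.comp hψ
    have hLc : HasCompactSupport (fun x => L (ψ x)) := hc.comp_left (g := L) (map_zero L)
    have hLs : tsupport (fun x => L (ψ x)) ⊆ Ioi (0 : ℝ) :=
      (closure_mono (Function.support_comp_subset (map_zero L) ψ)).trans hs
    have hLd : deriv (fun x => L (ψ x)) = fun x => L (deriv ψ x) := funext fun x =>
      (L.hasFDerivAt.comp_hasDerivAt x (hd x)).deriv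
    have h1 := h _ hL hLc hLs
    have h2 := integrable_test_smul (hL.continuous_deriv (by simp)) hLc.deriv u
    rw [hLd] at h1 h2
    exact ⟨h1, h2, integrable_test_smul hL.continuous hLc v⟩
  obtain ⟨h1, i1, j1⟩ := part Complex.reCLM
  obtain ⟨h2, i2, j2⟩ := part Complex.imCLM
  have split : ∀ z w : ℂ, z * w
      = Complex.reCLM z • w + Complex.I * (Complex.imCLM z • w) := by
    intro z w
    simp only [Complex.reCLM_apply, Complex.imCLM_apply, Complex.real_smul]
    conv_lhs => rw [← Complex.re_add_im z]
    ring
  simp only [split (deriv ψ _), split (ψ _)]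
  rw [integral_add i1 (i2.const_mul _), integral_add j1 (j2.const_mul _), integral_const_mul,
    integral_const_mul, h1, h2]
  ring

theorem deriv_smoothTransition_of_notMem {y : ℝ} (hy : y ∉ Icc (0 : ℝ) 1) :
    deriv Real.smoothTransition y = 0 := by
  rw [mem_Icc, not_and_or, not_le, not_le] at hy
  rcases hy with hy | hy
  · have : Real.smoothTransition =ᶠ[𝓝 y] fun _ => 0 := by
      filter_upwards [Iio_mem_nhds hy] with x hx
      exact Real.smoothTransition.zero_of_nonpos (le_of_lt hx)
    rw [this.deriv_eq, deriv_const]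
  · have : Real.smoothTransition =ᶠ[𝓝 y] fun _ => 1 := by
      filter_upwards [Ioi_mem_nhds hy] with x hx
      exact Real.smoothTransition.one_of_one_le (le_of_lt hx)
    rw [this.deriv_eq, deriv_const]

theorem continuous_deriv_smoothTransition : Continuous (deriv Real.smoothTransition) :=
  (Real.smoothTransition.contDiff (n := 1)).continuous_deriv le_rfl

theorem hasDerivAt_smoothTransition (y : ℝ) :
    HasDerivAt Real.smoothTransition (deriv Real.smoothTransition y) y :=
  ((Real.smoothTransition.contDiff (n := 1)).differentiable (by simp) y).hasDerivAt

theorem hasCompactSupport_deriv_smoothTransition :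
    HasCompactSupport (deriv Real.smoothTransition) :=
  HasCompactSupport.intro isCompact_Icc fun _ hy => deriv_smoothTransition_of_notMem hy

theorem exists_bound_deriv_smoothTransition :
    ∃ C : ℝ, 0 ≤ C ∧ ∀ y, |deriv Real.smoothTransition y| ≤ C := by
  obtain ⟨C, hC⟩ := hasCompactSupport_deriv_smoothTransition.exists_bound_of_continuous
    continuous_deriv_smoothTransition
  exact ⟨C, (norm_nonneg _).trans (hC 0), hC⟩

theorem integrable_deriv_smoothTransition_sub_one :
    Integrable fun y : ℝ => deriv Real.smoothTransition (y - 1) :=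
  (continuous_deriv_smoothTransition.integrable_of_hasCompactSupport
    hasCompactSupport_deriv_smoothTransition).comp_sub_right 1

theorem integral_deriv_smoothTransition_sub_one :
    ∫ y in Ioi (0 : ℝ), deriv Real.smoothTransition (y - 1) = 1 := by
  have h := integral_Ioi_of_hasDerivAt_of_tendsto' (a := (0 : ℝ)) (m := (1 : ℝ))
    (f := fun y => Real.smoothTransition (y - 1))
    (f' := fun y => deriv Real.smoothTransition (y - 1))
    (fun x _ => (hasDerivAt_smoothTransition (x - 1)).comp_sub_const x 1)
    integrable_deriv_smoothTransition_sub_one.integrableOn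
    (tendsto_const_nhds.congr' (by
      filter_upwards [eventually_ge_atTop (2 : ℝ)] with x hx
      exact (Real.smoothTransition.one_of_one_le (by linarith)).symm))
  rw [h, Real.smoothTransition.zero_of_nonpos (by norm_num), sub_zero]

/-- A smooth cutoff, supported in `[1/n, 2n]` and equal to one on `[2/n, n]`. -/
def cutoff (n x : ℝ) : ℝ := Real.smoothTransition (n * x - 1) * Real.smoothTransition (2 - x / n)

theorem cutoff_nonneg (n x : ℝ) : 0 ≤ cutoff n x :=
  mul_nonneg (Real.smoothTransition.nonneg _) (Real.smoothTransition.nonneg _)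

theorem cutoff_le_one (n x : ℝ) : cutoff n x ≤ 1 :=
  mul_le_one₀ (Real.smoothTransition.le_one _) (Real.smoothTransition.nonneg _)
    (Real.smoothTransition.le_one _)

theorem contDiff_cutoff (n : ℝ) : ContDiff ℝ ∞ (cutoff n) :=
  (Real.smoothTransition.contDiff.comp (by fun_prop)).mul
    (Real.smoothTransition.contDiff.comp (by fun_prop))

theorem cutoff_eq_zero {n x : ℝ} (hn : 0 < n) (hx : x ∉ Icc (1 / n) (2 * n)) :
    cutoff n x = 0 := by
  rw [mem_Icc, not_and_or, not_le, not_le] at hx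
  rcases hx with hx | hx
  · rw [lt_div_iff₀ hn] at hx
    rw [cutoff, Real.smoothTransition.zero_of_nonpos (by linarith), zero_mul]
  · have : 2 < x / n := by rwa [lt_div_iff₀ hn]
    rw [cutoff, Real.smoothTransition.zero_of_nonpos (x := 2 - x / n) (by linarith), mul_zero]

theorem cutoff_eq_one {n x : ℝ} (hn : 0 < n) (h1 : 2 ≤ n * x) (h2 : x ≤ n) : cutoff n x = 1 := by
  have : x / n ≤ 1 := by rwa [div_le_one hn]
  rw [cutoff, Real.smoothTransition.one_of_one_le (by linarith),
    Real.smoothTransition.one_of_one_le (by linarith), one_mul]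

/-- For `n ≥ 2` one has `2/n ≤ n`, so where the inner factor varies the outer one equals `1` and
drops out of the first term. This isolates a boundary layer at `0` from a tail of size `1/n`. -/
theorem hasDerivAt_cutoff {n : ℝ} (hn : 2 ≤ n) (x : ℝ) :
    HasDerivAt (cutoff n) (n * deriv Real.smoothTransition (n * x - 1)
      - Real.smoothTransition (n * x - 1) * deriv Real.smoothTransition (2 - x / n) / n) x := by
  have h1 : HasDerivAt (fun x => n * x - 1) n x := by
    simpa using ((hasDerivAt_id x).const_mul n).sub_const 1
  have h2 : HasDerivAt (fun x => 2 - x / n) (-(1 / n)) x :=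
    ((hasDerivAt_id x).div_const n).const_sub 2
  have h := ((hasDerivAt_smoothTransition _).comp x h1).mul
    ((hasDerivAt_smoothTransition _).comp x h2)
  refine h.congr_deriv ?_
  have h3 : deriv Real.smoothTransition (n * x - 1) * Real.smoothTransition (2 - x / n)
      = deriv Real.smoothTransition (n * x - 1) := by
    by_cases hx : n * x - 1 ∈ Icc (0 : ℝ) 1
    · have h4 : x / n ≤ 1 := by
        rw [div_le_one (by linarith)]
        nlinarith [hx.2]
      rw [Real.smoothTransition.one_of_one_le (by linarith), mul_one]
    · rw [deriv_smoothTransition_of_notMem hx, zero_mul]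
  simp only [Function.comp_apply]
  rw [mul_right_comm, h3]
  ring

theorem tendsto_natCast_add_two : Tendsto (fun n : ℕ => (n : ℝ) + 2) atTop atTop :=
  tendsto_natCast_atTop_atTop.atTop_add tendsto_const_nhds

theorem eventually_cutoff_eq_one {x : ℝ} (hx : 0 < x) :
    ∀ᶠ n : ℕ in atTop, cutoff ((n : ℝ) + 2) x = 1 := by
  filter_upwards [tendsto_natCast_add_two.eventually_ge_atTop (2 / x),
    tendsto_natCast_add_two.eventually_ge_atTop x] with n h1 h2
  refine cutoff_eq_one (by positivity) ?_ h2
  rwa [div_le_iff₀ hx] at h1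

theorem tendsto_integral_cutoff_mul {f : ℝ → ℂ} (hf : Integrable f branchMeasure) :
    Tendsto (fun n : ℕ => ∫ x in Ioi (0 : ℝ), (cutoff ((n : ℝ) + 2) x : ℂ) * f x) atTop
      (𝓝 (∫ x in Ioi (0 : ℝ), f x)) := by
  refine tendsto_integral_of_dominated_convergence (fun x => ‖f x‖) (fun n => ?_) hf.norm
    (fun n => ?_) ?_
  · exact (Complex.continuous_ofReal.comp (contDiff_cutoff _).continuous).aestronglyMeasurable.mul
      hf.aestronglyMeasurable
  · filter_upwards with x
    rw [norm_mul, Complex.norm_real, Real.norm_of_nonneg (cutoff_nonneg _ _)]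
    exact mul_le_of_le_one_left (norm_nonneg _) (cutoff_le_one _ _)
  · filter_upwards [ae_restrict_mem measurableSet_Ioi] with x hx
    refine tendsto_const_nhds.congr' ?_
    filter_upwards [eventually_cutoff_eq_one hx] with n hn
    rw [hn, Complex.ofReal_one, one_mul]

theorem tendsto_integral_tail {f : ℝ → ℂ} (hf : Integrable f branchMeasure) :
    Tendsto (fun n : ℕ => ∫ x in Ioi (0 : ℝ),
      ((Real.smoothTransition (((n : ℝ) + 2) * x - 1) *
        deriv Real.smoothTransition (2 - x / ((n : ℝ) + 2)) / ((n : ℝ) + 2) : ℝ) : ℂ) * f x) atTop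
      (𝓝 0) := by
  obtain ⟨C, hC0, hC⟩ := exists_bound_deriv_smoothTransition
  have hb : ∀ (n : ℕ) (x : ℝ), |Real.smoothTransition (((n : ℝ) + 2) * x - 1) *
        deriv Real.smoothTransition (2 - x / ((n : ℝ) + 2)) / ((n : ℝ) + 2)|
        ≤ C / ((n : ℝ) + 2) := by
    intro n x
    rw [abs_div, abs_mul, abs_of_nonneg (Real.smoothTransition.nonneg _),
      abs_of_pos (by positivity : (0 : ℝ) < (n : ℝ) + 2)]
    gcongr
    calc _ ≤ 1 * C := by
          gcongr
          · exact Real.smoothTransition.le_one _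
          · exact hC _
      _ = C := one_mul C
  have h0 : (0 : ℂ) = ∫ x in Ioi (0 : ℝ), (0 : ℂ) := by simp
  rw [h0]
  refine tendsto_integral_of_dominated_convergence (fun x => C * ‖f x‖) (fun n => ?_)
    (hf.norm.const_mul C) (fun n => ?_) ?_
  · refine AEStronglyMeasurable.mul (Continuous.aestronglyMeasurable ?_) hf.aestronglyMeasurable
    have := continuous_deriv_smoothTransition
    have := (Real.smoothTransition.contDiff (n := 1)).continuous
    fun_prop
  · filter_upwards with x
    rw [norm_mul, Complex.norm_real, Real.norm_eq_abs]
    gcongr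
    refine (hb n x).trans (div_le_self hC0 ?_)
    have : (0 : ℝ) ≤ n := by positivity
    linarith
  · filter_upwards with x
    rw [tendsto_zero_iff_norm_tendsto_zero]
    have h1 : Tendsto (fun n : ℕ => C / ((n : ℝ) + 2) * ‖f x‖) atTop (𝓝 0) := by
      have := (tendsto_natCast_add_two.const_div_atTop C).mul_const ‖f x‖
      simpa using this
    refine squeeze_zero (fun n => norm_nonneg _) (fun n => ?_) h1
    rw [norm_mul, Complex.norm_real, Real.norm_eq_abs]
    gcongr
    exact hb n x

/-- The weights form an approximate identity of mass one concentrating at `0` from the right; the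
substitution `y = (n + 2) x` turns this into dominated convergence on a fixed compact set. -/
theorem tendsto_integral_boundary {f : ℝ → ℂ} (hf : ContinuousOn f (Ici 0)) :
    Tendsto (fun n : ℕ => ∫ x in Ioi (0 : ℝ),
      ((((n : ℝ) + 2) * deriv Real.smoothTransition (((n : ℝ) + 2) * x - 1) : ℝ) : ℂ) * f x) atTop
      (𝓝 (f 0)) := by
  have hsub : ∀ n : ℕ, ∫ x in Ioi (0 : ℝ),
      ((((n : ℝ) + 2) * deriv Real.smoothTransition (((n : ℝ) + 2) * x - 1) : ℝ) : ℂ) * f x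
      = ∫ y in Ioi (0 : ℝ),
        ((deriv Real.smoothTransition (y - 1) : ℝ) : ℂ) * f (((n : ℝ) + 2)⁻¹ * y) := by
    intro n
    have hn : (0 : ℝ) < (n : ℝ) + 2 := by positivity
    have := integral_comp_mul_left_Ioi
      (fun y => ((deriv Real.smoothTransition (y - 1) : ℝ) : ℂ) * f (((n : ℝ) + 2)⁻¹ * y)) 0 hn
    rw [mul_zero, eq_inv_smul_iff₀ hn.ne', ← integral_smul] at this
    rw [← this]
    refine integral_congr_ae (Eventually.of_forall fun x => ?_)
    simp only [inv_mul_cancel_left₀ hn.ne', Complex.real_smul]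
    push_cast
    ring
  simp only [hsub]
  obtain ⟨K, hK⟩ := isCompact_Icc.exists_bound_of_continuousOn
    (hf.mono fun x (hx : x ∈ Icc (0 : ℝ) 2) => hx.1)
  have hlim : f 0 = ∫ y in Ioi (0 : ℝ), ((deriv Real.smoothTransition (y - 1) : ℝ) : ℂ) * f 0 := by
    rw [integral_mul_const, integral_complex_ofReal, integral_deriv_smoothTransition_sub_one,
      Complex.ofReal_one, one_mul]
  rw [hlim]
  have hmem : ∀ (n : ℕ) (y : ℝ), 0 < y → 0 ≤ ((n : ℝ) + 2)⁻¹ * y := fun n y hy => by positivity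
  refine tendsto_integral_of_dominated_convergence
    (fun y => |deriv Real.smoothTransition (y - 1)| * K) (fun n => ?_)
    (integrable_deriv_smoothTransition_sub_one.abs.mul_const K).integrableOn (fun n => ?_) ?_
  · have hc := continuous_deriv_smoothTransition
    refine ContinuousOn.aestronglyMeasurable (ContinuousOn.mul ?_ ?_) measurableSet_Ioi
    · exact Continuous.continuousOn (by fun_prop)
    · exact hf.comp (by fun_prop) fun y hy => hmem n y hy
  · filter_upwards [ae_restrict_mem measurableSet_Ioi] with y hy
    rw [norm_mul, Complex.norm_real, Real.norm_eq_abs]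
    by_cases h : y - 1 ∈ Icc (0 : ℝ) 1
    · gcongr
      refine hK _ ⟨hmem n y hy, ?_⟩
      have h1 : ((n : ℝ) + 2)⁻¹ ≤ 1 := inv_le_one_of_one_le₀ (by
        have : (0 : ℝ) ≤ n := by positivity
        linarith)
      have hy' : (0 : ℝ) < y := hy
      nlinarith [h.2]
    · rw [deriv_smoothTransition_of_notMem h]
      simp
  · filter_upwards [ae_restrict_mem measurableSet_Ioi] with y hy
    refine Tendsto.const_mul _ ?_
    refine (hf 0 self_mem_Ici).tendsto.comp (tendsto_nhdsWithin_iff.2 ⟨?_, ?_⟩)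
    · have := (tendsto_inv_atTop_zero.comp tendsto_natCast_add_two).mul_const y
      simpa using this
    · exact Eventually.of_forall fun n => hmem n y hy

/-- Integration by parts on the half-line for a weakly differentiable function with a
representative which is continuous up to the boundary. -/
theorem HasWeakDeriv.integral_deriv_schwartz_mul {u v : BranchL2} (h : HasWeakDeriv u v)
    {g : ℝ → ℂ} (hg : ContinuousOn g (Ici 0)) (hu : u =ᵐ[branchMeasure] g) (φ : 𝓢(ℝ, ℂ)) :
    ∫ x in Ioi (0 : ℝ), deriv φ x * u x
      = -(φ 0 * g 0) - ∫ x in Ioi (0 : ℝ), φ x * v x := by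
  have hφ2 : MemLp φ 2 volume := φ.memLp 2 volume
  have hφd : MemLp (deriv φ) 2 volume := (SchwartzMap.derivCLM ℂ ℂ φ).memLp 2 volume
  have i1 := integrable_mul_branch hφd u
  have i2 := integrable_mul_branch hφ2 v
  have i3 := integrable_mul_branch hφ2 u
  -- The test function is `cutoff · φ`, supported inside `(0, ∞)`; the product rule gives a main
  -- term, a boundary layer and a tail. In the boundary layer `u` is replaced by `g`, which has a
  -- value at `0`. The shift `n + 2` secures the condition `2 ≤ N` of `hasDerivAt_cutoff`.
  have key : ∀ n : ℕ,
      (∫ x in Ioi (0 : ℝ), (cutoff ((n : ℝ) + 2) x : ℂ) * (deriv φ x * u x)) +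
      ((∫ x in Ioi (0 : ℝ),
        ((((n : ℝ) + 2) * deriv Real.smoothTransition (((n : ℝ) + 2) * x - 1) : ℝ) : ℂ) *
          (φ x * g x)) -
       ∫ x in Ioi (0 : ℝ), ((Real.smoothTransition (((n : ℝ) + 2) * x - 1) *
        deriv Real.smoothTransition (2 - x / ((n : ℝ) + 2)) / ((n : ℝ) + 2) : ℝ) : ℂ) *
          (φ x * u x))
      = -∫ x in Ioi (0 : ℝ), (cutoff ((n : ℝ) + 2) x : ℂ) * (φ x * v x) := by
    intro n
    set N : ℝ := (n : ℝ) + 2 with hN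
    have hN2 : 2 ≤ N := by
      have : (0 : ℝ) ≤ n := by positivity
      linarith
    have hN0 : 0 < N := by linarith
    have hψ : ContDiff ℝ ∞ (fun x => (cutoff N x : ℂ) * φ x) :=
      (Complex.ofRealCLM.contDiff.comp (contDiff_cutoff N)).mul (φ.smooth ⊤)
    have hsupp : Function.support (fun x => (cutoff N x : ℂ) * φ x) ⊆ Icc (1 / N) (2 * N) := by
      intro x hx
      by_contra hx'
      exact hx (by simp [cutoff_eq_zero hN0 hx'])
    have hts : tsupport (fun x => (cutoff N x : ℂ) * φ x) ⊆ Icc (1 / N) (2 * N) :=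
      closure_minimal hsupp isClosed_Icc
    have hψc : HasCompactSupport (fun x => (cutoff N x : ℂ) * φ x) :=
      isCompact_Icc.of_isClosed_subset isClosed_closure hts
    have h1 := h.integral_deriv_mul hψ hψc
      (hts.trans fun x hx => lt_of_lt_of_le (by positivity) hx.1)
    have hd : ∀ x, deriv (fun x => (cutoff N x : ℂ) * φ x) x
        = ((N * deriv Real.smoothTransition (N * x - 1)
      - Real.smoothTransition (N * x - 1) * deriv Real.smoothTransition (2 - x / N) / N : ℝ) : ℂ)
        * φ x + (cutoff N x : ℂ) * deriv φ x := fun x =>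
      ((hasDerivAt_cutoff hN2 x).ofReal_comp.mul (φ.hasDerivAt x)).deriv
    simp only [mul_assoc] at h1 ⊢
    rw [← h1]
    have hst := (Real.smoothTransition.contDiff (n := 1)).continuous
    have hst' := continuous_deriv_smoothTransition
    obtain ⟨C, hC0, hC⟩ := exists_bound_deriv_smoothTransition
    have e2 : ∫ x in Ioi (0 : ℝ), ((N * deriv Real.smoothTransition (N * x - 1) : ℝ) : ℂ) *
          (φ x * g x) = ∫ x in Ioi (0 : ℝ),
          ((N * deriv Real.smoothTransition (N * x - 1) : ℝ) : ℂ) * (φ x * u x) := by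
      refine integral_congr_ae ?_
      filter_upwards [hu] with x hx
      rw [hx]
    have j1 : Integrable (fun x => (cutoff N x : ℂ) * (deriv φ x * u x)) branchMeasure := by
      refine i1.bdd_mul (c := 1) (Complex.continuous_ofReal.comp
        (contDiff_cutoff N).continuous).aestronglyMeasurable (Eventually.of_forall fun x => ?_)
      rw [Complex.norm_real, Real.norm_of_nonneg (cutoff_nonneg _ _)]
      exact cutoff_le_one _ _
    have j2 : Integrable (fun x => ((N * deriv Real.smoothTransition (N * x - 1) : ℝ) : ℂ) *
        (φ x * u x)) branchMeasure := by
      refine i3.bdd_mul (c := N * C) (Continuous.aestronglyMeasurable (by fun_prop))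
        (Eventually.of_forall fun x => ?_)
      rw [Complex.norm_real, norm_mul, Real.norm_of_nonneg hN0.le]
      gcongr
      exact hC _
    have j3 : Integrable (fun x => ((Real.smoothTransition (N * x - 1) *
        deriv Real.smoothTransition (2 - x / N) / N : ℝ) : ℂ) *
        (φ x * u x)) branchMeasure := by
      refine i3.bdd_mul (c := 1 * C / N) (Continuous.aestronglyMeasurable (by fun_prop))
        (Eventually.of_forall fun x => ?_)
      rw [Complex.norm_real, norm_div, norm_mul, Real.norm_of_nonneg hN0.le,
        Real.norm_of_nonneg (Real.smoothTransition.nonneg _)]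
      gcongr
      · exact Real.smoothTransition.le_one _
      · exact hC _
    have j23 := integral_sub j2 j3
    rw [e2, ← j23]
    refine (integral_add j1 (j2.sub j3)).symm.trans ?_
    refine integral_congr_ae (Eventually.of_forall fun x => ?_)
    simp only [hd, Pi.sub_apply]
    push_cast
    ring
  have t1 := (tendsto_integral_cutoff_mul i1).add
    ((tendsto_integral_boundary (f := fun x => φ x * g x)
      (φ.continuous.continuousOn.mul hg)).sub (tendsto_integral_tail i3))
  have t2 := (tendsto_integral_cutoff_mul i2).neg
  have := tendsto_nhds_unique (t1.congr key) t2
  rw [sub_zero] at this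
  linear_combination this

/-! ### Weak derivatives and regularity from the Fourier side -/

/-- The Fourier symbol of `d/dx`. -/
def derivSymbol (ξ : ℝ) : ℂ := 2 * Real.pi * Complex.I * ξ

theorem derivSymbol_mul_self (ξ : ℝ) : derivSymbol ξ * derivSymbol ξ = -(symbol ξ : ℂ) := by
  simp only [derivSymbol, symbol]
  push_cast
  linear_combination (4 * (Real.pi : ℂ) ^ 2 * ξ ^ 2) * Complex.I_mul_I

theorem norm_derivSymbol_sq (ξ : ℝ) : ‖derivSymbol ξ‖ ^ 2 = symbol ξ := by
  rw [derivSymbol, symbol, norm_mul, norm_mul, norm_mul, Complex.norm_I, Complex.norm_real,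
    Complex.norm_real, Real.norm_eq_abs, Real.norm_eq_abs, mul_one, mul_pow, mul_pow, sq_abs,
    sq_abs]
  simp [mul_pow]

theorem continuous_derivSymbol : Continuous derivSymbol := by
  unfold derivSymbol; fun_prop

theorem hasTemperateGrowth_derivSymbol : derivSymbol.HasTemperateGrowth := by
  unfold derivSymbol; fun_prop

/-- Multiplication by the Fourier symbol of `d/dx`, on Schwartz functions. -/
def derivSymbolMul : 𝓢(ℝ, ℂ) →L[ℂ] 𝓢(ℝ, ℂ) := smulLeftCLM ℂ derivSymbol

theorem derivSymbolMul_apply (φ : 𝓢(ℝ, ℂ)) (ξ : ℝ) :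
    derivSymbolMul φ ξ = derivSymbol ξ * φ ξ :=
  smulLeftCLM_apply_apply hasTemperateGrowth_derivSymbol φ ξ

theorem derivCLM_fourier (φ : 𝓢(ℝ, ℂ)) :
    derivCLM ℂ ℂ (𝓕 φ) = -𝓕 (derivSymbolMul φ) := by
  ext x
  rw [← FourierTransform.fourier_neg, derivCLM_apply, SchwartzMap.fourier_coe,
    SchwartzMap.fourier_coe]
  have h : Integrable (fun x : ℝ => x • φ x) := by
    refine (integrable_norm_iff (by fun_prop)).1 ?_
    simpa [norm_smul] using φ.integrable_pow_mul volume 1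
  rw [Real.deriv_fourier φ.integrable h]
  refine congrArg (fun f : ℝ → ℂ => (𝓕 f : ℝ → ℂ) x) (funext fun ξ => ?_)
  change _ = -(derivSymbolMul φ ξ)
  rw [derivSymbolMul_apply, derivSymbol, smul_eq_mul]
  ring

theorem fourierInv_derivCLM (φ : 𝓢(ℝ, ℂ)) :
    𝓕⁻ (derivCLM ℂ ℂ φ) = -derivSymbolMul (𝓕⁻ φ) := by
  have h := derivCLM_fourier (𝓕⁻ φ)
  rw [fourier_fourierInv_eq (E := 𝓢(ℝ, ℂ)) (F := 𝓢(ℝ, ℂ)), ← FourierTransform.fourier_neg] at h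
  rw [h]
  exact fourierInv_fourier_eq (E := 𝓢(ℝ, ℂ)) (F := 𝓢(ℝ, ℂ)) _

/-- If `F'' = -G` in the sense of tempered distributions, then `(2πξ)² 𝓕F = 𝓕G`. -/
theorem symbol_mul_fourier_of_forall_schwartz {F G : LineL2}
    (h : ∀ φ : 𝓢(ℝ, ℂ), ∫ x, derivCLM ℂ ℂ (derivCLM ℂ ℂ φ) x * F x = -∫ x, φ x * G x) :
    ∀ᵐ ξ, (symbol ξ : ℂ) * (𝓕 F : LineL2) ξ = (𝓕 G : LineL2) ξ := by
  have hs : Continuous fun ξ => (symbol ξ : ℂ) := by unfold symbol; fun_prop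
  refine ae_eq_of_forall_schwartz ?_ (locallyIntegrable_lp _) fun φ => ?_
  · exact (locallyIntegrable_lp (𝓕 F)).continuous_mul hs
  · have e : ∀ ξ, φ ξ * ((symbol ξ : ℂ) * (𝓕 F : LineL2) ξ)
        = -(derivSymbolMul (derivSymbolMul φ) ξ * (𝓕 F : LineL2) ξ) := by
      intro ξ
      rw [derivSymbolMul_apply, derivSymbolMul_apply]
      linear_combination (φ ξ * (𝓕 F : LineL2) ξ) * derivSymbol_mul_self ξ
    simp only [e]
    rw [integral_neg, integral_mul_fourier, integral_mul_fourier, eq_comm, ← neg_inj, neg_neg,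
      ← h (𝓕 φ), derivCLM_fourier, map_neg, derivCLM_fourier, neg_neg]

/-- If `𝓕V = 2πiξ 𝓕F` then `F' = V` in the sense of tempered distributions. -/
theorem integral_derivCLM_mul_of_fourier {F V : LineL2}
    (h : ∀ᵐ ξ, (𝓕 V : LineL2) ξ = derivSymbol ξ * (𝓕 F : LineL2) ξ) (φ : 𝓢(ℝ, ℂ)) :
    ∫ x, derivCLM ℂ ℂ φ x * F x = -∫ x, φ x * V x := by
  have hF := integral_mul_fourierInv (derivCLM ℂ ℂ φ) (𝓕 F)
  have hV := integral_mul_fourierInv φ (𝓕 V)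
  rw [fourierInv_fourier_eq (E := LineL2) (F := LineL2)] at hF hV
  rw [hF, hV, fourierInv_derivCLM, ← integral_neg]
  refine integral_congr_ae ?_
  filter_upwards [h] with ξ hξ
  rw [hξ]
  change -(derivSymbolMul (𝓕⁻ φ) ξ) * _ = _
  rw [derivSymbolMul_apply]
  ring

theorem hasWeakDeriv_restrictHalf {F V : LineL2}
    (h : ∀ φ : 𝓢(ℝ, ℂ), ∫ x, derivCLM ℂ ℂ φ x * F x = -∫ x, φ x * V x) :
    HasWeakDeriv (restrictHalf F) (restrictHalf V) := by
  intro φ hφ hc hs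
  have hc' : HasCompactSupport (fun x => (φ x : ℂ)) := hc.comp_left (g := Complex.ofReal) rfl
  have h1 := h (hc'.toSchwartzMap (Complex.ofRealCLM.contDiff.comp hφ))
  have hd : ∀ x, derivCLM ℂ ℂ (hc'.toSchwartzMap (Complex.ofRealCLM.contDiff.comp hφ)) x
      = ((deriv φ x : ℝ) : ℂ) := fun x =>
    ((hφ.differentiable (by simp) x).hasDerivAt.ofReal_comp).deriv
  have key : ∀ (ψ : ℝ → ℝ) (H : LineL2), (∀ x, x ∉ Ioi (0 : ℝ) → ψ x = 0) →
      ∫ x in Ioi (0 : ℝ), ψ x • restrictHalf H x = ∫ x, (ψ x : ℂ) * H x := by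
    intro ψ H hψ
    rw [← setIntegral_eq_integral_of_forall_compl_eq_zero (s := Ioi (0 : ℝ))
      (f := fun x => (ψ x : ℂ) * H x)
      (fun x hx => by rw [hψ x hx, Complex.ofReal_zero, zero_mul])]
    refine integral_congr_ae ?_
    filter_upwards [coeFn_restrictHalf H] with x hx
    rw [hx, Complex.real_smul]
  rw [key _ _ fun x hx => ?_, key _ _ fun x hx => ?_]
  · simp only [hd] at h1
    exact h1
  · exact image_eq_zero_of_notMem_tsupport fun h' => hx (hs h')
  · exact image_eq_zero_of_notMem_tsupport fun h' => hx (hs (tsupport_deriv_subset h'))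

theorem memLp_inv_one_add_derivSymbol :
    MemLp (fun ξ => (1 + derivSymbol ξ)⁻¹) 2 volume := by
  have hne : ∀ ξ, 1 + derivSymbol ξ ≠ 0 := by
    intro ξ h
    have := congrArg Complex.re h
    simp [derivSymbol] at this
  have hc : Continuous fun ξ => (1 + derivSymbol ξ)⁻¹ :=
    (continuous_const.add continuous_derivSymbol).inv₀ hne
  rw [memLp_two_iff_integrable_sq_norm hc.aestronglyMeasurable]
  have h := (integrable_inv_one_add_sq.comp_mul_left' (R := 2 * Real.pi) (by positivity))
  refine h.congr (Eventually.of_forall fun ξ => ?_)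
  have : ‖1 + derivSymbol ξ‖ ^ 2 = 1 + (2 * Real.pi * ξ) ^ 2 := by
    rw [← Complex.normSq_eq_norm_sq, Complex.normSq_apply]
    simp [derivSymbol]
    ring
  simp only [norm_inv, inv_pow, this]

/-- The Fourier form of the embedding of `H¹` into bounded functions: `p = (1 + 2πiξ)⁻¹ (p + q)` is
a product of two `L²` functions. -/
theorem integrable_of_derivSymbol_mul {p q : LineL2} (h : ∀ᵐ ξ, q ξ = derivSymbol ξ * p ξ) :
    Integrable p := by
  have h1 := memLp_one_iff_integrable.1 ((Lp.memLp (p + q)).mul memLp_inv_one_add_derivSymbol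
    (r := 1))
  refine h1.congr ?_
  filter_upwards [h, Lp.coeFn_add p q] with ξ h2 h3
  have hne : 1 + derivSymbol ξ ≠ 0 := by
    intro h
    have := congrArg Complex.re h
    simp [derivSymbol] at this
  rw [Pi.mul_apply, h3, Pi.add_apply, h2]
  field_simp

/-- An `H²` function on the line: first and second derivatives exist weakly and there is a `C¹`
representative. -/
theorem exists_deriv_of_symbol_mul_fourier {F G : LineL2}
    (h : ∀ᵐ ξ, (symbol ξ : ℂ) * (𝓕 F : LineL2) ξ = (𝓕 G : LineL2) ξ) :
    (∃ V : LineL2, (∀ φ : 𝓢(ℝ, ℂ), ∫ x, derivCLM ℂ ℂ φ x * F x = -∫ x, φ x * V x) ∧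
      ∀ φ : 𝓢(ℝ, ℂ), ∫ x, derivCLM ℂ ℂ φ x * V x = -∫ x, φ x * (-G : LineL2) x) ∧
    ∃ P : ℝ → ℂ, ContDiff ℝ 1 P ∧ F =ᵐ[volume] P := by
  -- The first derivative is in `L²` because `|2πξ| ≤ 1 + (2πξ)²`.
  have hq : MemLp (fun ξ => derivSymbol ξ * (𝓕 F : LineL2) ξ) 2 volume := by
    refine MemLp.mono' ((Lp.memLp (𝓕 F)).norm.add (Lp.memLp (𝓕 G)).norm)
      (continuous_derivSymbol.aestronglyMeasurable.mul (Lp.aestronglyMeasurable _)) ?_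
    filter_upwards [h] with ξ hξ
    rw [Pi.add_apply, ← hξ, norm_mul, norm_mul, Complex.norm_real, ← norm_derivSymbol_sq,
      Real.norm_of_nonneg (sq_nonneg _), ← one_add_mul]
    gcongr
    nlinarith [sq_nonneg (‖derivSymbol ξ‖ - 1)]
  have hV : ∀ᵐ ξ, (𝓕 (𝓕⁻ (hq.toLp _) : LineL2) : LineL2) ξ
      = derivSymbol ξ * (𝓕 F : LineL2) ξ := by
    rw [fourier_fourierInv_eq (E := LineL2) (F := LineL2)]
    exact hq.coeFn_toLp
  set V : LineL2 := 𝓕⁻ (hq.toLp _)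
  have hG : ∀ᵐ ξ, (𝓕 (-G) : LineL2) ξ = derivSymbol ξ * (𝓕 V : LineL2) ξ := by
    rw [FourierTransform.fourier_neg]
    filter_upwards [hV, h, Lp.coeFn_neg (𝓕 G : LineL2)] with ξ h1 h2 h3
    rw [h3, Pi.neg_apply, h1, ← h2, ← mul_assoc, derivSymbol_mul_self, neg_mul]
  refine ⟨⟨V, integral_derivCLM_mul_of_fourier hV, integral_derivCLM_mul_of_fourier hG⟩, ?_⟩
  have i1 : Integrable (𝓕 F : LineL2) := integrable_of_derivSymbol_mul hV
  have i2 : Integrable (𝓕 V : LineL2) := integrable_of_derivSymbol_mul hG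
  have i3 : Integrable fun ξ => ‖ξ‖ * ‖(𝓕 F : LineL2) ξ‖ := by
    refine (i2.norm.const_mul (2 * Real.pi)⁻¹).congr ?_
    filter_upwards [hV] with ξ hξ
    rw [hξ, norm_mul, derivSymbol, norm_mul, norm_mul, norm_mul, Complex.norm_I,
      Complex.norm_real, Complex.norm_real, Real.norm_of_nonneg Real.pi_pos.le]
    have := Real.pi_pos
    simp
    field_simp
  -- Both `𝓕F` and `ξ 𝓕F` are integrable, so the inverse Fourier integral of `𝓕F` is `C¹`.
  refine ⟨𝓕⁻ ((𝓕 F : LineL2) : ℝ → ℂ), ?_, ?_⟩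
  · have hcd : ContDiff ℝ ((1 : ℕ∞) : WithTop ℕ∞) (𝓕 ((𝓕 F : LineL2) : ℝ → ℂ)) := by
      refine Real.contDiff_fourier fun n hn => ?_
      have hn' : n ≤ 1 := by exact_mod_cast hn
      interval_cases n
      · simpa using i1.norm
      · simpa using i3
    have : 𝓕⁻ ((𝓕 F : LineL2) : ℝ → ℂ) = fun x => 𝓕 ((𝓕 F : LineL2) : ℝ → ℂ) (-x) :=
      funext fun x => Real.fourierInv_eq_fourier_neg _ x
    rw [this]
    exact hcd.comp contDiff_neg
  · have := fourierInv_ae_eq i1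
    rwa [fourierInv_fourier_eq (E := LineL2) (F := LineL2)] at this

/-! ### Traces at the vertex and the second derivative of a glued function -/

theorem integrable_smul_of_tsupport_subset {ψ : ℝ → ℝ} (hψ : Continuous ψ)
    (hc : HasCompactSupport ψ) (hs : tsupport ψ ⊆ Ioi (0 : ℝ)) {q : ℝ → ℂ}
    (hq : ContinuousOn q (Ici 0)) : Integrable (fun x => ψ x • q x) := by
  have h1 : IntegrableOn (fun x => ψ x • q x) (tsupport ψ) :=
    (hψ.continuousOn.smul (hq.mono (hs.trans Ioi_subset_Ici_self))).integrableOn_compact hc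
  refine (integrableOn_iff_integrable_of_support_subset fun x hx => ?_).1 h1
  exact subset_tsupport ψ fun h => hx (by simp [h])

/-- Classical integration by parts against a test function supported away from `0` has no boundary
term, so both derivatives have the same pairings. It gives `v` a representative continuous up to
`0`, as a second integration by parts requires. -/
theorem HasWeakDeriv.ae_eq_derivWithin {u v : BranchL2} (h : HasWeakDeriv u v) {g : ℝ → ℂ}
    (hg : ContDiffOn ℝ 1 g (Ici 0)) (hu : u =ᵐ[branchMeasure] g) :
    v =ᵐ[branchMeasure] derivWithin g (Ici 0) := by
  have hg' : ContinuousOn (derivWithin g (Ici 0)) (Ici 0) :=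
    hg.continuousOn_derivWithin (uniqueDiffOn_Ici 0) le_rfl
  have hgd : ∀ x ∈ Ioi (0 : ℝ), HasDerivAt g (derivWithin g (Ici 0) x) x := fun x hx =>
    ((hg.differentiableOn (by simp) x (Ioi_subset_Ici_self hx)).hasDerivWithinAt).hasDerivAt
      (Ici_mem_nhds hx)
  have key : ∀ᵐ x ∂(volume : Measure ℝ), x ∈ Ioi (0 : ℝ) →
      v x - derivWithin g (Ici 0) x = 0 := by
    refine isOpen_Ioi.ae_eq_zero_of_integral_contDiff_smul_eq_zero ?_ ?_
    · refine LocallyIntegrableOn.sub ?_ ((hg'.mono Ioi_subset_Ici_self).locallyIntegrableOn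
        measurableSet_Ioi)
      rw [locallyIntegrableOn_iff (isOpen_Ioi.isLocallyClosed)]
      intro K hK hKc
      have hm := (Lp.memLp v).mono_measure (Measure.restrict_mono hK le_rfl)
      have : IsFiniteMeasure (volume.restrict K) := ⟨by simpa using hKc.measure_lt_top⟩
      exact hm.integrable (by norm_num)
    · intro φ hφ hc hs
      have hz : ∀ x, x ∉ Ioi (0 : ℝ) → φ x = 0 := fun x hx =>
        image_eq_zero_of_notMem_tsupport fun h' => hx (hs h')
      have i1 := integrable_smul_of_tsupport_subset hφ.continuous hc hs hg'
      have i2 := integrable_smul_of_tsupport_subset (hφ.continuous_deriv (by simp)) hc.deriv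
        (tsupport_deriv_subset.trans hs) hg.continuousOn
      have hw := h φ hφ hc hs
      have e1 : ∫ x in Ioi (0 : ℝ), deriv φ x • u x = ∫ x in Ioi (0 : ℝ), deriv φ x • g x := by
        refine integral_congr_ae ?_
        filter_upwards [hu] with x hx
        rw [hx]
      have e2 : ∫ x in Ioi (0 : ℝ), (φ x • derivWithin g (Ici 0) x + deriv φ x • g x) = 0 := by
        rw [integral_Ioi_of_hasDerivAt_of_tendsto (f := fun x => φ x • g x) (m := 0)]
        · simp [hz 0 (by simp)]
        · exact (hφ.continuous.continuousWithinAt).smul (hg.continuousOn 0 self_mem_Ici)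
        · exact fun x hx => ((hφ.differentiable (by simp) x).hasDerivAt).smul (hgd x hx)
        · exact (i1.add i2).integrableOn
        · refine tendsto_const_nhds.congr' ?_
          obtain ⟨R, hR⟩ := hc.isCompact.bddAbove
          filter_upwards [eventually_gt_atTop R] with x hx
          rw [image_eq_zero_of_notMem_tsupport fun h' => not_le.2 hx (hR h'), zero_smul]
      rw [integral_add i1.integrableOn i2.integrableOn, ← e1, hw] at e2
      rw [← setIntegral_eq_integral_of_forall_compl_eq_zero (s := Ioi (0 : ℝ))
        (fun x hx => by rw [hz x hx, zero_smul])]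
      simp only [smul_sub]
      rw [integral_sub (integrable_test_smul hφ.continuous hc v) i1.integrableOn]
      linear_combination -e2
  have key' := (ae_restrict_iff' (μ := (volume : Measure ℝ)) (measurableSet_Ioi (a := (0 : ℝ)))).2 key
  filter_upwards [key'] with x hx
  exact sub_eq_zero.1 hx

/-- Integration by parts twice on the half-line. -/
theorem integral_deriv_deriv_schwartz_mul {u v w : BranchL2} (h1 : HasWeakDeriv u v)
    (h2 : HasWeakDeriv v w) {g : ℝ → ℂ} (hg : ContDiffOn ℝ 1 g (Ici 0))
    (hu : u =ᵐ[branchMeasure] g) (φ : 𝓢(ℝ, ℂ)) :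
    ∫ x in Ioi (0 : ℝ), derivCLM ℂ ℂ (derivCLM ℂ ℂ φ) x * u x
      = -(derivCLM ℂ ℂ φ 0 * g 0) + φ 0 * derivWithin g (Ici 0) 0
        + ∫ x in Ioi (0 : ℝ), φ x * w x := by
  have e1 := h1.integral_deriv_schwartz_mul hg.continuousOn hu (derivCLM ℂ ℂ φ)
  have e2 := h2.integral_deriv_schwartz_mul
    (hg.continuousOn_derivWithin (uniqueDiffOn_Ici 0) le_rfl) (h1.ae_eq_derivWithin hg hu) φ
  simp only [derivCLM_apply] at e1 ⊢
  rw [e1, e2]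
  ring

/-- The matching conditions make the glued function `C¹` across `0`, so its distributional second
derivative has no point mass there. In the pairing, `h0` removes the terms in `φ'(0)` and `h1` those
in `φ(0)`. -/
theorem symbol_mul_fourier_glue {a va wa b vb wb : BranchL2} {ga gb : ℝ → ℂ}
    (ha : HasWeakDeriv a va) (ha' : HasWeakDeriv va wa) (hga : ContDiffOn ℝ 1 ga (Ici 0))
    (haga : a =ᵐ[branchMeasure] ga)
    (hb : HasWeakDeriv b vb) (hb' : HasWeakDeriv vb wb) (hgb : ContDiffOn ℝ 1 gb (Ici 0))
    (hbgb : b =ᵐ[branchMeasure] gb) (h0 : ga 0 = gb 0)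
    (h1 : derivWithin ga (Ici 0) 0 + derivWithin gb (Ici 0) 0 = 0) :
    ∀ᵐ ξ, (symbol ξ : ℂ) * (𝓕 (glue a b) : LineL2) ξ = (𝓕 (glue (-wa) (-wb)) : LineL2) ξ := by
  refine symbol_mul_fourier_of_forall_schwartz fun φ => ?_
  let ψ : 𝓢(ℝ, ℂ) := compCLMOfContinuousLinearEquiv ℂ (ContinuousLinearEquiv.neg ℝ) φ
  have hψ : ∀ x, ψ x = φ (-x) := fun x => rfl
  have hψ1 : ∀ x, derivCLM ℂ ℂ ψ x = -derivCLM ℂ ℂ φ (-x) := fun x => by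
    rw [derivCLM_apply, derivCLM_apply]
    exact deriv_comp_neg φ x
  have hψ2 : ∀ x, derivCLM ℂ ℂ (derivCLM ℂ ℂ ψ) x = derivCLM ℂ ℂ (derivCLM ℂ ℂ φ) (-x) := by
    intro x
    rw [derivCLM_apply, derivCLM_apply _ (derivCLM ℂ ℂ φ)]
    have : (derivCLM ℂ ℂ ψ : ℝ → ℂ) = fun x => -derivCLM ℂ ℂ φ (-x) := funext hψ1
    rw [this, deriv.fun_neg, deriv_comp_neg, neg_neg]
  have e1 := integral_deriv_deriv_schwartz_mul ha ha' hga haga φ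
  have e2 := integral_deriv_deriv_schwartz_mul hb hb' hgb hbgb ψ
  have hneg : ∀ (χ : ℝ → ℂ) (c : BranchL2),
      ∫ x in Ioi (0 : ℝ), χ x * (-c : BranchL2) x = -∫ x in Ioi (0 : ℝ), χ x * c x := by
    intro χ c
    rw [← integral_neg]
    refine integral_congr_ae ?_
    filter_upwards [Lp.coeFn_neg c] with x hx
    rw [hx, Pi.neg_apply, mul_neg]
  rw [integral_mul_glue ((derivCLM ℂ ℂ (derivCLM ℂ ℂ φ)).memLp 2 volume),
    integral_mul_glue (φ.memLp 2 volume), hneg, hneg, e1]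
  simp only [hψ2] at e2
  rw [e2, hψ1]
  simp only [hψ, neg_zero]
  linear_combination (-(derivCLM ℂ ℂ φ 0)) * h0 + φ 0 * h1

/-! ### The dispersive estimate on the line -/

/-- Convolutions with normalised bumps of shrinking support converge to `f` almost everywhere, and
each is the pairing of `f` with a nonnegative test function of mass one. -/
theorem ae_norm_le_of_forall_test {f : ℝ → ℂ} (hf : LocallyIntegrable f) {K : ℝ}
    (h : ∀ φ : ℝ → ℝ, ContDiff ℝ ∞ φ → HasCompactSupport φ → (∀ x, 0 ≤ φ x) →
      ‖∫ x, φ x • f x‖ ≤ K * ∫ x, φ x) : ∀ᵐ x, ‖f x‖ ≤ K := by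
  let φ : ℕ → ContDiffBump (0 : ℝ) := fun n =>
    ⟨1 / ((n : ℝ) + 1), 2 * (1 / ((n : ℝ) + 1)), by positivity, by
      have : 0 < 1 / ((n : ℝ) + 1) := by positivity
      linarith⟩
  have h1 : Tendsto (fun n => (φ n).rOut) atTop (𝓝 0) := by
    have := (tendsto_one_div_add_atTop_nhds_zero_nat (𝕜 := ℝ)).const_mul 2
    rwa [mul_zero] at this
  have h2 := ContDiffBump.ae_convolution_tendsto_right_of_locallyIntegrable (μ := volume) h1
    (K := 2) (Eventually.of_forall fun n => le_rfl) hf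
  filter_upwards [h2] with x hx
  refine le_of_tendsto hx.norm (Eventually.of_forall fun n => ?_)
  rw [convolution_eq_swap]
  simp only [ContinuousLinearMap.lsmul_apply]
  have h3 := h (fun y => (φ n).normed volume (x - y))
    ((φ n).contDiff_normed.comp (contDiff_const.sub contDiff_id))
    ((φ n).hasCompactSupport_normed.comp_homeomorph (Homeomorph.subLeft x))
    (fun y => (φ n).nonneg_normed _)
  rw [integral_sub_left_eq_self, (φ n).integral_normed, mul_one] at h3
  exact h3

/-- The damped multiplier `e^{(it - ε)(2πξ)²}`. -/
def dampedPhase (ε t ξ : ℝ) : ℂ :=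
  Complex.exp (-Real.pi * (4 * Real.pi * (ε - t * Complex.I)) * ξ ^ 2)

theorem dampedPhase_eq (ε t ξ : ℝ) :
    dampedPhase ε t ξ = Complex.exp (-(ε * symbol ξ : ℝ)) * phase t ξ := by
  rw [dampedPhase, phase, ← Complex.exp_add, symbol]
  push_cast
  ring_nf

theorem norm_dampedPhase_le {ε : ℝ} (hε : 0 ≤ ε) (t ξ : ℝ) : ‖dampedPhase ε t ξ‖ ≤ 1 := by
  rw [dampedPhase_eq, norm_mul, norm_phase, mul_one, ← Complex.ofReal_neg,
    Complex.norm_exp_ofReal, Real.exp_le_one_iff, symbol]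
  nlinarith [mul_nonneg hε (sq_nonneg (2 * Real.pi * ξ))]

theorem continuous_dampedPhase (ε t : ℝ) : Continuous (dampedPhase ε t) := by
  unfold dampedPhase; fun_prop

theorem continuous_dampedPhase_left (t ξ : ℝ) : Continuous fun ε => dampedPhase ε t ξ := by
  unfold dampedPhase; fun_prop

theorem dampedPhase_zero (t ξ : ℝ) : dampedPhase 0 t ξ = phase t ξ := by
  simp [dampedPhase_eq]

/-- A modulated Gaussian. -/
def modulated (ε t x ξ : ℝ) : ℂ :=
  Complex.exp (-Real.pi * (4 * Real.pi * (ε - t * Complex.I)) * ξ ^ 2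
    + 2 * Real.pi * (-Complex.I * x) * ξ)

theorem modulated_eq (ε t x ξ : ℝ) :
    modulated ε t x ξ = Complex.exp ((-2 * Real.pi * ξ * x : ℝ) * Complex.I) * dampedPhase ε t ξ := by
  rw [modulated, dampedPhase, ← Complex.exp_add]
  push_cast
  ring_nf

theorem integrable_modulated {ε : ℝ} (hε : 0 < ε) (t x : ℝ) : Integrable (modulated ε t x) := by
  have hre : ((-Real.pi * (4 * Real.pi * (ε - t * Complex.I)) : ℂ)).re < 0 := by
    have : ((-Real.pi * (4 * Real.pi * (ε - t * Complex.I)) : ℂ)).re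
        = -(4 * Real.pi ^ 2 * ε) := by
      simp
      ring
    rw [this]
    have := Real.pi_pos
    have : 0 < 4 * Real.pi ^ 2 * ε := by positivity
    linarith
  have := integrable_cexp_quadratic' hre (2 * Real.pi * (-Complex.I * x)) 0
  simp only [add_zero] at this
  exact this

/-- The transform is `b^{-1/2} exp(-π(x - y)²/b)` with `b = 4π(ε - it)`. As `Re(1/b) > 0` the
exponential has modulus at most `1`, and `|b| ≥ 4π|t| ≥ |t|`. The bound is uniform in `ε`. -/
theorem norm_fourierInv_modulated_le {ε : ℝ} (hε : 0 < ε) {t : ℝ} (ht : t ≠ 0) (x y : ℝ) :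
    ‖𝓕⁻ (modulated ε t x) y‖ ≤ |t| ^ (-(1 / 2) : ℝ) := by
  set b : ℂ := 4 * Real.pi * (ε - t * Complex.I) with hb
  have hre : b.re = 4 * Real.pi * ε := by simp [hb]
  have him : b.im = -(4 * Real.pi * t) := by simp [hb]
  have hpi := Real.pi_pos
  have hbre : 0 < b.re := by rw [hre]; positivity
  have hnorm : |t| ≤ ‖b‖ := by
    refine le_trans ?_ (Complex.abs_im_le_norm b)
    rw [him, abs_neg, abs_mul, abs_of_pos (by positivity : 0 < 4 * Real.pi)]
    have := Real.pi_gt_three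
    nlinarith [abs_nonneg t]
  have hf := congrFun (fourier_gaussian_pi' hbre (-Complex.I * x)) (-y)
  rw [Real.fourierInv_eq_fourier_neg]
  change ‖𝓕 (fun ξ : ℝ => Complex.exp (-Real.pi * b * ξ ^ 2 + 2 * Real.pi * (-Complex.I * x) * ξ))
    (-y)‖ ≤ _
  rw [hf, norm_mul, norm_div, norm_one]
  have h2 : ‖Complex.exp (-Real.pi / b * (((-y : ℝ) : ℂ) + Complex.I * (-Complex.I * x)) ^ 2)‖
      ≤ 1 := by
    have e : ((-y : ℝ) : ℂ) + Complex.I * (-Complex.I * x) = ((x - y : ℝ) : ℂ) := by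
      push_cast
      linear_combination (-(x : ℂ)) * Complex.I_mul_I
    rw [e, Complex.norm_exp, Real.exp_le_one_iff, ← Complex.ofReal_pow, Complex.re_mul_ofReal,
      div_eq_mul_inv, ← Complex.ofReal_neg, Complex.re_ofReal_mul, Complex.inv_re]
    have : 0 ≤ b.re / Complex.normSq b := div_nonneg hbre.le (Complex.normSq_nonneg b)
    nlinarith [mul_nonneg (mul_nonneg hpi.le this) (sq_nonneg (x - y))]
  have h3 : ‖b ^ (1 / 2 : ℂ)‖ = ‖b‖ ^ (1 / 2 : ℝ) := by
    rw [← Complex.norm_cpow_real]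
    norm_num
  rw [h3]
  calc 1 / ‖b‖ ^ (1 / 2 : ℝ) * _ ≤ 1 / |t| ^ (1 / 2 : ℝ) * 1 := by
        have := abs_pos.2 ht
        gcongr
    _ = |t| ^ (-(1 / 2) : ℝ) := by rw [mul_one, Real.rpow_neg (abs_nonneg t), one_div]

/-- The character `e^{-2πiξx}` is absorbed into the Gaussian, and the inverse transform is moved
from `φ` onto it. -/
theorem norm_fourier_dampedPhase_mul_le {ε : ℝ} (hε : 0 < ε) {t : ℝ} (ht : t ≠ 0)
    (φ : 𝓢(ℝ, ℂ)) (x : ℝ) :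
    ‖𝓕 (fun ξ => dampedPhase ε t ξ * 𝓕⁻ φ ξ) x‖ ≤ |t| ^ (-(1 / 2) : ℝ) * ∫ y, ‖φ y‖ := by
  rw [Real.fourier_real_eq_integral_exp_smul]
  have e : ∀ ξ : ℝ, Complex.exp ((-2 * Real.pi * ξ * x : ℝ) * Complex.I) •
      (dampedPhase ε t ξ * 𝓕⁻ φ ξ) = modulated ε t x ξ * 𝓕⁻ (φ : ℝ → ℂ) ξ := by
    intro ξ
    rw [modulated_eq, smul_eq_mul, ← mul_assoc, SchwartzMap.fourierInv_coe]
  simp only [e]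
  rw [integral_mul_fourierInv_fun (integrable_modulated hε t x) φ.integrable]
  calc ‖∫ y, 𝓕⁻ (modulated ε t x) y * φ y‖
      ≤ ∫ y, |t| ^ (-(1 / 2) : ℝ) * ‖φ y‖ := by
        refine norm_integral_le_of_norm_le (φ.integrable.norm.const_mul _)
          (Eventually.of_forall fun y => ?_)
        rw [norm_mul]
        gcongr
        exact norm_fourierInv_modulated_le hε ht x y
    _ = _ := integral_const_mul _ _

/-- The undamped multiplier is not integrable, so the bound is proved with damping `ε = 1/(n + 1)`
and passed to the limit, with `𝓕⁻φ · 𝓕F` integrable. -/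
theorem norm_integral_mul_lineGroup_le {t : ℝ} (ht : t ≠ 0) (φ : 𝓢(ℝ, ℂ)) {F : LineL2}
    (hF : Integrable F) :
    ‖∫ x, φ x * lineGroup t F x‖ ≤ |t| ^ (-(1 / 2) : ℝ) * (∫ y, ‖φ y‖) * ∫ x, ‖F x‖ := by
  obtain ⟨χ, hχ⟩ : ∃ χ : 𝓢(ℝ, ℂ), χ = 𝓕⁻ φ := ⟨_, rfl⟩
  obtain ⟨Fh, hFh'⟩ : ∃ Fh : ℝ → ℂ, Fh = 𝓕 (F : ℝ → ℂ) := ⟨_, rfl⟩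
  have hFh : (𝓕 F : LineL2) =ᵐ[volume] Fh := hFh' ▸ fourier_ae_eq hF
  have hI : Integrable (fun ξ => χ ξ * Fh ξ) := by
    have := memLp_one_iff_integrable.1 ((Lp.memLp (𝓕 F : LineL2)).mul (χ.memLp 2 volume)
      (r := 1))
    refine this.congr ?_
    filter_upwards [hFh] with ξ hξ
    rw [Pi.mul_apply, hξ]
  have e1 : ∫ x, φ x * lineGroup t F x
      = ∫ ξ, phase t ξ * (χ ξ * Fh ξ) := by
    rw [lineGroup_apply, integral_mul_fourierInv, ← hχ]
    refine integral_congr_ae ?_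
    filter_upwards [coeFn_phaseMul t (𝓕 F), hFh] with ξ h1 h2
    rw [h1, h2]
    ring
  have hlim : Tendsto (fun n : ℕ => ∫ ξ, dampedPhase (1 / ((n : ℝ) + 1)) t ξ *
      (χ ξ * Fh ξ)) atTop (𝓝 (∫ x, φ x * lineGroup t F x)) := by
    rw [e1]
    refine tendsto_integral_of_dominated_convergence
      (fun ξ => ‖χ ξ * Fh ξ‖) (fun n => ?_) hI.norm (fun n => ?_) ?_
    · exact (continuous_dampedPhase _ t).aestronglyMeasurable.mul hI.aestronglyMeasurable
    · filter_upwards with ξ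
      rw [norm_mul]
      exact mul_le_of_le_one_left (norm_nonneg _) (norm_dampedPhase_le (by positivity) t ξ)
    · filter_upwards with ξ
      have := ((continuous_dampedPhase_left t ξ).tendsto 0).comp
        (tendsto_one_div_add_atTop_nhds_zero_nat (𝕜 := ℝ))
      rw [dampedPhase_zero] at this
      exact this.mul_const _
  refine le_of_tendsto hlim.norm (Eventually.of_forall fun n => ?_)
  have hε : 0 < 1 / ((n : ℝ) + 1) := by positivity
  have hint : Integrable fun ξ => dampedPhase (1 / ((n : ℝ) + 1)) t ξ * χ ξ :=
    χ.integrable.bdd_mul (c := 1) (continuous_dampedPhase _ t).aestronglyMeasurable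
      (Eventually.of_forall fun ξ => norm_dampedPhase_le hε.le t ξ)
  have e2 : ∫ ξ, dampedPhase (1 / ((n : ℝ) + 1)) t ξ * (χ ξ * Fh ξ)
      = ∫ x, 𝓕 (fun ξ => dampedPhase (1 / ((n : ℝ) + 1)) t ξ * χ ξ) x * F x := by
    rw [← integral_mul_fourier_fun hint hF, ← hFh']
    simp only [mul_assoc]
  rw [e2]
  refine (norm_integral_le_of_norm_le (hF.norm.const_mul
    (|t| ^ (-(1 / 2) : ℝ) * ∫ y, ‖φ y‖)) (Eventually.of_forall fun x => ?_)).trans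
      (integral_const_mul _ _).le
  rw [norm_mul]
  gcongr
  rw [hχ]
  exact norm_fourier_dampedPhase_mul_le hε ht φ x

/-- The dispersive estimate on the line. -/
theorem eLpNorm_top_lineGroup_le {t : ℝ} (ht : t ≠ 0) {F : LineL2} (hF : eLpNorm F 1 volume < ⊤) :
    eLpNorm (lineGroup t F) ⊤ volume
      ≤ ENNReal.ofReal (|t| ^ (-(1 / 2) : ℝ)) * eLpNorm F 1 volume := by
  have hFi : Integrable F := memLp_one_iff_integrable.1 ⟨Lp.aestronglyMeasurable F, hF⟩
  have hb : ∀ᵐ x, ‖lineGroup t F x‖ ≤ |t| ^ (-(1 / 2) : ℝ) * ∫ x, ‖F x‖ := by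
    refine ae_norm_le_of_forall_test (locallyIntegrable_lp _) fun φ hφ hc h0 => ?_
    have hc' : HasCompactSupport (fun x => (φ x : ℂ)) := hc.comp_left (g := Complex.ofReal) rfl
    have h1 := norm_integral_mul_lineGroup_le ht
      (hc'.toSchwartzMap (Complex.ofRealCLM.contDiff.comp hφ)) hFi
    have h2 : ∀ x, ‖hc'.toSchwartzMap (Complex.ofRealCLM.contDiff.comp hφ) x‖ = φ x := fun x =>
      (Complex.norm_real _).trans (Real.norm_of_nonneg (h0 x))
    simp only [h2] at h1
    rw [mul_right_comm] at h1
    exact h1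
  rw [eLpNorm_exponent_top]
  refine (eLpNormEssSup_le_of_ae_bound hb).trans ?_
  rw [ENNReal.ofReal_mul (by positivity), ofReal_integral_norm_eq_lintegral_enorm hFi,
    eLpNorm_one_eq_lintegral_enorm]

/-! ### Uniqueness of a unitary group with given generator -/

section Uniqueness

variable {E : Type*} [NormedAddCommGroup E] [InnerProductSpace ℂ E] {A : E →ₗ.[ℂ] E}
  {U V : ℝ → E ≃ₗᵢ[ℂ] E}

theorem IsUnitaryGroupOf.map_zero (hU : IsUnitaryGroupOf A U) (f : E) : U 0 f = f :=
  (U 0).injective (by rw [← hU.map_add, add_zero])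

/-- Since `U t` commutes with every `U s`, applying it to the derivative at `0` shows both that the
domain is invariant and that `A` commutes with `U t`. -/
theorem IsUnitaryGroupOf.hasDerivAt (hU : IsUnitaryGroupOf A U) {f g : E}
    (h : (f, g) ∈ A.graph) (t : ℝ) :
    HasDerivAt (fun s => U s f) (Complex.I • U t g) t ∧ (U t f, U t g) ∈ A.graph := by
  have h0 := (hU.generator f g).1 h
  have h1 : HasDerivAt (fun s => U t (U s f)) (Complex.I • U t g) 0 := by
    have := hasDerivAt_clm_apply (U t).toContinuousLinearEquiv.toContinuousLinearMap h0
    exact this.congr_deriv ((U t).map_smul _ _)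
  constructor
  · have h2 : HasDerivAt (fun s => U t (U s f)) (Complex.I • U t g) (t - t) := by rwa [sub_self]
    refine (h2.comp_sub_const t t).congr_of_eventuallyEq (Eventually.of_forall fun s => ?_)
    simp only
    rw [← hU.map_add, add_sub_cancel]
  · refine (hU.generator _ _).2 (h1.congr_of_eventuallyEq (Eventually.of_forall fun s => ?_))
    simp only
    rw [← hU.map_add, ← hU.map_add, add_comm]

/-- The time averages `h⁻¹ ∫₀ʰ U s f ds` lie in the domain and tend to `f` as `h → 0`. -/
theorem IsUnitaryGroupOf.exists_tendsto_domain [CompleteSpace E] (hU : IsUnitaryGroupOf A U)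
    (f : E) : ∃ F : ℕ → E, (∀ n, ∃ g, (F n, g) ∈ A.graph) ∧ Tendsto F atTop (𝓝 f) := by
  have hcont := hU.continuous f
  have hint : ∀ a b : ℝ, IntervalIntegrable (fun s => U s f) volume a b := fun a b =>
    hcont.intervalIntegrable a b
  have hd : ∀ b : ℝ, HasDerivAt (fun b => ∫ s in (0 : ℝ)..b, U s f) (U b f) b := fun b =>
    intervalIntegral.integral_hasDerivAt_right (hint 0 b)
      hcont.stronglyMeasurable.stronglyMeasurableAtFilter hcont.continuousAt
  have hdom : ∀ h : ℝ, ∃ g, ((∫ s in (0 : ℝ)..h, U s f), g) ∈ A.graph := by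
    intro h
    -- As `U t ∫₀ʰ = ∫₀^{h+t} - ∫₀ᵗ`, the derivative at `t = 0` is `U h f - U 0 f`, which must equal
    -- `i g`.
    refine ⟨-Complex.I • (U h f - U 0 f), (hU.generator _ _).2 ?_⟩
    have e : ∀ t, U t (∫ s in (0 : ℝ)..h, U s f)
        = (∫ s in (0 : ℝ)..(h + t), U s f) - ∫ s in (0 : ℝ)..t, U s f := by
      intro t
      have h1 : U t (∫ s in (0 : ℝ)..h, U s f) = ∫ s in (0 : ℝ)..h, U t (U s f) :=
        ((U t).toContinuousLinearEquiv.toContinuousLinearMap.intervalIntegral_comp_comm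
          (hint 0 h)).symm
      rw [h1, intervalIntegral.integral_interval_sub_left (hint _ _) (hint _ _)]
      simp only [← hU.map_add]
      rw [intervalIntegral.integral_comp_add_left (fun s => U s f), add_zero, add_comm]
    have hd1 : HasDerivAt (fun t => ∫ s in (0 : ℝ)..(h + t), U s f) (U h f) 0 := by
      have := hd (h + 0)
      rw [add_zero] at this
      have h2 : HasDerivAt (fun b => ∫ s in (0 : ℝ)..b, U s f) (U h f) (h + 0) := by
        rwa [add_zero]
      exact h2.comp_const_add h 0
    refine ((hd1.sub (hd 0)).congr_deriv ?_).congr_of_eventuallyEq (Eventually.of_forall e)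
    rw [smul_smul, mul_neg, Complex.I_mul_I, neg_neg, one_smul]
  refine ⟨fun n => ((n : ℝ) + 1) • ∫ s in (0 : ℝ)..(1 / ((n : ℝ) + 1)), U s f, fun n => ?_, ?_⟩
  · obtain ⟨g, hg⟩ := hdom (1 / ((n : ℝ) + 1))
    refine ⟨(((n : ℝ) + 1 : ℝ) : ℂ) • g, ?_⟩
    have := A.graph.smul_mem (((n : ℝ) + 1 : ℝ) : ℂ) hg
    rw [Prod.smul_mk, Complex.coe_smul] at this
    exact this
  · have h0 := (hasDerivAt_iff_tendsto_slope.1 (hd 0)).comp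
      (tendsto_nhdsWithin_iff.2 ⟨tendsto_one_div_add_atTop_nhds_zero_nat (𝕜 := ℝ),
        Eventually.of_forall fun n => by
          simp only [mem_compl_iff, mem_singleton_iff]; positivity⟩)
    rw [hU.map_zero] at h0
    refine h0.congr fun n => ?_
    simp [slope_def_module]

theorem IsUnitaryGroupOf.unique [CompleteSpace E] (hU : IsUnitaryGroupOf A U)
    (hV : IsUnitaryGroupOf A V) : U = V := by
  have key : ∀ f g, (f, g) ∈ A.graph → ∀ t, U t f = V t f := by
    intro f g hfg t
    have hd : ∀ t, HasDerivAt (fun s => ‖U s f - V s f‖ ^ 2) 0 t := by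
      intro t
      obtain ⟨d1, m1⟩ := hU.hasDerivAt hfg t
      obtain ⟨d2, m2⟩ := hV.hasDerivAt hfg t
      have hm : (U t f - V t f, U t g - V t g) ∈ A.graph := A.graph.sub_mem m1 m2
      -- The derivative of `‖w‖²` for `w = U t f - V t f` is `2 Re ⟨w, iAw⟩`. It vanishes without
      -- assuming `A` symmetric: it is also the derivative at `0` of the constant `‖U s w‖²`.
      have d3 := (hU.hasDerivAt hm 0).1
      rw [hU.map_zero] at d3
      let : InnerProductSpace ℝ E := InnerProductSpace.rclikeToReal ℂ E
      have n3 := d3.norm_sq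
      have n4 := (d1.sub d2).norm_sq
      rw [← smul_sub] at n4
      simp only [LinearIsometryEquiv.norm_map] at n3
      have hz := n3.unique (hasDerivAt_const 0 _)
      rw [hU.map_zero] at hz
      exact n4.congr_deriv hz
    have hc := is_const_of_deriv_eq_zero (fun t => (hd t).differentiableAt)
      (fun t => (hd t).deriv) t 0
    simp only [hU.map_zero, hV.map_zero, sub_self, norm_zero] at hc
    exact sub_eq_zero.1 (norm_eq_zero.1 (by simpa using hc))
  ext t f
  obtain ⟨F, hF, hlim⟩ := hU.exists_tendsto_domain f
  refine tendsto_nhds_unique (((U t).continuous.tendsto f).comp hlim)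
    ((((V t).continuous.tendsto f).comp hlim).congr fun n => ?_)
  obtain ⟨g, hg⟩ := hF n
  exact (key _ _ hg t).symm

end Uniqueness

/-! ### Vertex scattering and the graph of `H₀` -/

/-- `glue` as a continuous linear map. -/
def glueCLM : BranchL2 × BranchL2 →L[ℂ] LineL2 :=
  extendZero.toContinuousLinearMap.comp (ContinuousLinearMap.fst ℂ _ _) +
    (reflect.toContinuousLinearMap.comp extendZero.toContinuousLinearMap).comp
      (ContinuousLinearMap.snd ℂ _ _)

theorem glueCLM_apply (p : BranchL2 × BranchL2) : glueCLM p = glue p.1 p.2 := rfl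

variable {N : ℕ}

/-- The vertex scattering map `u_k ↦ (2/N) ∑_j u_j - u_k`, as a linear map. -/
def scatterₗ (N : ℕ) : NetworkL2 N →ₗ[ℂ] NetworkL2 N where
  toFun u := WithLp.toLp 2 fun k => (2 / N : ℂ) • ∑ j, u j - u k
  map_add' u v := by
    ext1 k
    simp only [PiLp.add_apply, Finset.sum_add_distrib, smul_add]
    abel
  map_smul' c u := by
    ext1 k
    simp only [PiLp.smul_apply, ← Finset.smul_sum, RingHom.id_apply, smul_sub]
    rw [smul_comm]

theorem scatterₗ_apply (u : NetworkL2 N) (k : Fin N) :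
    scatterₗ N u k = (2 / N : ℂ) • ∑ j, u j - u k := rfl

/-- The map is `2P - 1` with `P` the projection onto equal components. On expanding, `N (2/N)² ‖∑
u_j‖²` cancels the cross terms. -/
theorem norm_scatterₗ [NeZero N] (u : NetworkL2 N) : ‖scatterₗ N u‖ = ‖u‖ := by
  have hN : (N : ℝ) ≠ 0 := Nat.cast_ne_zero.2 (NeZero.ne N)
  have h : ‖scatterₗ N u‖ ^ 2 = ‖u‖ ^ 2 := by
    rw [PiLp.norm_sq_eq_of_L2, PiLp.norm_sq_eq_of_L2]
    have hk : ∀ k, ‖scatterₗ N u k‖ ^ 2 = (2 / N) ^ 2 * ‖∑ j, u j‖ ^ 2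
        - 2 * ((2 / N) * RCLike.re (inner ℂ (∑ j, u j) (u k))) + ‖u k‖ ^ 2 := by
      intro k
      rw [scatterₗ_apply, @norm_sub_sq ℂ, norm_smul, mul_pow, inner_smul_left]
      have e : (2 / N : ℂ) = ((2 / N : ℝ) : ℂ) := by push_cast; rfl
      rw [e, Complex.conj_ofReal, Complex.norm_real, Real.norm_eq_abs, sq_abs]
      congr 3
      exact Complex.re_ofReal_mul _ _
    simp only [hk]
    rw [Finset.sum_add_distrib, Finset.sum_sub_distrib, Finset.sum_const, ← Finset.mul_sum,
      ← Finset.mul_sum, ← map_sum, ← inner_sum, inner_self_eq_norm_sq, Finset.card_univ,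
      Fintype.card_fin, nsmul_eq_mul]
    field_simp
    ring
  exact (sq_eq_sq₀ (norm_nonneg _) (norm_nonneg _)).1 h

/-- The vertex scattering map, as an isometry. -/
def scatter (N : ℕ) [NeZero N] : NetworkL2 N →ₗᵢ[ℂ] NetworkL2 N := ⟨scatterₗ N, norm_scatterₗ⟩

/-- Uniqueness of weak derivatives removes the choice made in `secondDeriv`. -/
theorem mem_graph_freeKirchhoff {f g : NetworkL2 N} :
    (f, g) ∈ (freeKirchhoff N).graph ↔ SatisfiesKirchhoff f ∧
      ∀ k, ∃ v, HasWeakDeriv (f k) v ∧ HasWeakDeriv v (-g k) := by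
  rw [LinearPMap.mem_graph_iff]
  constructor
  · rintro ⟨⟨f', hf⟩, rfl, rfl⟩
    refine ⟨hf.2, fun k => ?_⟩
    obtain ⟨v, w, h1, h2⟩ := hf.1 k
    refine ⟨v, h1, ?_⟩
    change HasWeakDeriv v (-(-secondDeriv (f' k) (hf.1 k)))
    rw [neg_neg, secondDeriv_eq (hf.1 k) h1 h2]
    exact h2
  · rintro ⟨h1, h2⟩
    refine ⟨⟨f, fun k => ?_, h1⟩, rfl, ?_⟩
    · obtain ⟨v, hv⟩ := h2 k
      exact ⟨v, _, hv⟩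
    · ext1 k
      obtain ⟨v, hv1, hv2⟩ := h2 k
      change -secondDeriv (f k) _ = g k
      rw [secondDeriv_eq _ hv1 hv2, neg_neg]

theorem HasWeakDeriv.sum {ι : Type*} (s : Finset ι) {u v : ι → BranchL2}
    (h : ∀ i ∈ s, HasWeakDeriv (u i) (v i)) : HasWeakDeriv (∑ i ∈ s, u i) (∑ i ∈ s, v i) := by
  classical
  induction s using Finset.induction_on with
  | empty => simpa using hasWeakDeriv_zero
  | insert a s ha ih =>
    rw [Finset.sum_insert ha, Finset.sum_insert ha]
    exact (h a (Finset.mem_insert_self a s)).add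
      (ih fun i hi => h i (Finset.mem_insert_of_mem hi))

theorem coeFn_sum_branch {ι : Type*} (s : Finset ι) (u : ι → BranchL2) :
    (∑ i ∈ s, u i : BranchL2) =ᵐ[branchMeasure] fun x => ∑ i ∈ s, u i x := by
  classical
  induction s using Finset.induction_on with
  | empty =>
    simp only [Finset.sum_empty]
    exact Lp.coeFn_zero ℂ 2 branchMeasure
  | insert a s ha ih =>
    rw [Finset.sum_insert ha]
    filter_upwards [Lp.coeFn_add (u a) (∑ i ∈ s, u i), ih] with x h1 h2
    rw [h1, Pi.add_apply, h2, Finset.sum_insert ha]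

theorem eLpNorm_one_sum_branch_le {ι : Type*} (s : Finset ι) (u : ι → BranchL2) :
    eLpNorm (∑ i ∈ s, u i : BranchL2) 1 branchMeasure
      ≤ ∑ i ∈ s, eLpNorm (u i) 1 branchMeasure := by
  have h : (∑ i ∈ s, u i : BranchL2) =ᵐ[branchMeasure] ∑ i ∈ s, (u i : ℝ → ℂ) := by
    filter_upwards [coeFn_sum_branch s u] with x hx
    rw [hx, Finset.sum_apply]
  rw [eLpNorm_congr_ae h]
  exact eLpNorm_sum_le (fun i _ => Lp.aestronglyMeasurable _) le_rfl

theorem eLpNorm_one_glue_le (a b : BranchL2) :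
    eLpNorm (glue a b) 1 volume ≤ eLpNorm a 1 branchMeasure + eLpNorm b 1 branchMeasure := by
  have hE : ∀ c : BranchL2, eLpNorm (extendZero c) 1 volume = eLpNorm c 1 branchMeasure := by
    intro c
    rw [eLpNorm_congr_ae (coeFn_extendZero c),
      eLpNorm_indicator_eq_eLpNorm_restrict measurableSet_Ioi]
  have hR : ∀ F : LineL2, eLpNorm (reflect F) 1 volume = eLpNorm F 1 volume := by
    intro F
    rw [eLpNorm_congr_ae (coeFn_reflect F)]
    exact eLpNorm_comp_measurePreserving (Lp.aestronglyMeasurable F)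
      (Measure.measurePreserving_neg volume)
  rw [glue, eLpNorm_congr_ae (Lp.coeFn_add _ _), ← hE a, ← hE b, ← hR (extendZero b)]
  exact eLpNorm_add_le (Lp.aestronglyMeasurable _) (Lp.aestronglyMeasurable _) le_rfl

variable [NeZero N]

theorem scatter_apply (u : NetworkL2 N) (k : Fin N) :
    scatter N u k = (2 / N : ℂ) • ∑ j, u j - u k := rfl

theorem scatter_scatter (u : NetworkL2 N) : scatter N (scatter N u) = u := by
  have hN : (N : ℂ) ≠ 0 := Nat.cast_ne_zero.2 (NeZero.ne N)
  ext1 k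
  simp only [scatter_apply, Finset.sum_sub_distrib, Finset.sum_const, Finset.card_univ,
    Fintype.card_fin, ← Nat.cast_smul_eq_nsmul ℂ, smul_smul, smul_sub]
  have : (2 / N : ℂ) * (N * (2 / N)) = 2 / N + 2 / N := by
    field_simp
    norm_num
  rw [this, add_smul]
  abel

/-! ### Unfolding and the network group -/

/-- The `k`-th branch of a network function, extended to the line by the vertex scattering. -/
def unfold (k : Fin N) : NetworkL2 N →L[ℂ] LineL2 :=
  glueCLM.comp ((PiLp.proj 2 (fun _ : Fin N => BranchL2) k).prod
    ((PiLp.proj 2 (fun _ : Fin N => BranchL2) k).comp (scatter N).toContinuousLinearMap))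

theorem unfold_apply (k : Fin N) (u : NetworkL2 N) :
    unfold k u = glue (u k) (scatter N u k) := rfl

theorem restrictHalf_unfold (k : Fin N) (u : NetworkL2 N) : restrictHalf (unfold k u) = u k :=
  restrictHalf_glue _ _

theorem reflect_unfold (k : Fin N) (u : NetworkL2 N) :
    reflect (unfold k u) = unfold k (scatter N u) := by
  rw [unfold_apply, unfold_apply, reflect_glue, scatter_scatter]

theorem unfold_scatter (k : Fin N) (u : NetworkL2 N) :
    unfold k (scatter N u) = (2 / N : ℂ) • ∑ j, unfold j u - unfold k u := by
  simp only [unfold_apply, ← glueCLM_apply (_, _)]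
  rw [← map_sum, ← map_smul, ← map_sub]
  congr 1
  ext1
  · simp [scatter_apply, Prod.fst_sum]
  · simp [scatter_apply (scatter N u), Prod.snd_sum]

/-- The group `e^{itH₀}` as a family of maps. -/
def networkGroupFun (t : ℝ) (u : NetworkL2 N) : NetworkL2 N :=
  WithLp.toLp 2 fun k => restrictHalf (lineGroup t (unfold k u))

theorem networkGroupFun_apply (t : ℝ) (u : NetworkL2 N) (k : Fin N) :
    networkGroupFun t u k = restrictHalf (lineGroup t (unfold k u)) := rfl

/-- Evolution preserves unfoldings: the reflected half of the evolved line is the evolution of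
`unfold k (scatter N u)`, a fixed linear combination of the `unfold j u`. The group law and
unitarity then come from the line. -/
theorem unfold_networkGroupFun (t : ℝ) (u : NetworkL2 N) (k : Fin N) :
    unfold k (networkGroupFun t u) = lineGroup t (unfold k u) := by
  rw [← glue_restrictHalf (lineGroup t (unfold k u)), ← lineGroup_reflect, reflect_unfold,
    unfold_scatter, unfold_apply, scatter_apply]
  simp only [networkGroupFun_apply, map_sub, map_smul, map_sum]

theorem networkGroupFun_add (s t : ℝ) (u : NetworkL2 N) :
    networkGroupFun (s + t) u = networkGroupFun s (networkGroupFun t u) := by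
  ext1 k
  rw [networkGroupFun_apply, networkGroupFun_apply, unfold_networkGroupFun, lineGroup_add]

theorem networkGroupFun_zero (u : NetworkL2 N) : networkGroupFun 0 u = u := by
  ext1 k
  rw [networkGroupFun_apply, lineGroup_zero, restrictHalf_unfold]

theorem sum_norm_sq_unfold (u : NetworkL2 N) : ∑ k, ‖unfold k u‖ ^ 2 = 2 * ‖u‖ ^ 2 := by
  simp only [unfold_apply, norm_sq_glue, Finset.sum_add_distrib]
  rw [← PiLp.norm_sq_eq_of_L2, ← PiLp.norm_sq_eq_of_L2, LinearIsometry.norm_map, two_mul]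

theorem norm_networkGroupFun (t : ℝ) (u : NetworkL2 N) : ‖networkGroupFun t u‖ = ‖u‖ := by
  have h := sum_norm_sq_unfold (networkGroupFun t u)
  simp only [unfold_networkGroupFun, LinearIsometry.norm_map] at h
  rw [sum_norm_sq_unfold] at h
  exact (sq_eq_sq₀ (norm_nonneg _) (norm_nonneg _)).1 (by linarith)

/-- The unitary group `e^{itH₀}` on the network. -/
def networkGroup (N : ℕ) [NeZero N] (t : ℝ) : NetworkL2 N ≃ₗᵢ[ℂ] NetworkL2 N where
  toFun := networkGroupFun t
  invFun := networkGroupFun (-t)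
  left_inv u := by rw [← networkGroupFun_add, neg_add_cancel, networkGroupFun_zero]
  right_inv u := by rw [← networkGroupFun_add, add_neg_cancel, networkGroupFun_zero]
  map_add' u v := by
    ext1 k
    simp only [networkGroupFun_apply, map_add, PiLp.add_apply]
  map_smul' c u := by
    ext1 k
    simp only [networkGroupFun_apply, map_smul, PiLp.smul_apply, RingHom.id_apply]
  norm_map' := norm_networkGroupFun t

theorem networkGroup_apply (t : ℝ) (u : NetworkL2 N) (k : Fin N) :
    networkGroup N t u k = restrictHalf (lineGroup t (unfold k u)) := rfl

theorem unfold_networkGroup (t : ℝ) (u : NetworkL2 N) (k : Fin N) :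
    unfold k (networkGroup N t u) = lineGroup t (unfold k u) := unfold_networkGroupFun t u k

theorem continuous_networkGroup (u : NetworkL2 N) : Continuous fun t => networkGroup N t u :=
  (PiLp.continuous_toLp 2 _).comp (continuous_pi fun k =>
    restrictHalf.continuous.comp (continuous_lineGroup (unfold k u)))

/-! ### The generator of the network group -/

theorem hasDerivAt_networkGroup_iff (f g : NetworkL2 N) :
    HasDerivAt (fun t => networkGroup N t f) (Complex.I • g) 0 ↔
      ∀ k, ∀ᵐ ξ, (symbol ξ : ℂ) * (𝓕 (unfold k f) : LineL2) ξ
        = (𝓕 (unfold k g) : LineL2) ξ := by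
  simp only [← hasDerivAt_lineGroup_iff]
  constructor
  · intro h k
    have := hasDerivAt_clm_apply (unfold k) h
    simp only [unfold_networkGroup, map_smul] at this
    exact this
  · intro h
    have h1 : HasDerivAt (fun t k => restrictHalf (lineGroup t (unfold k f)))
        (fun k => Complex.I • g k) 0 := by
      refine hasDerivAt_pi.2 fun k => ?_
      have := hasDerivAt_clm_apply restrictHalf (h k)
      rwa [map_smul, restrictHalf_unfold] at this
    exact hasDerivAt_clm_apply
      (PiLp.continuousLinearEquiv 2 ℂ (fun _ : Fin N => BranchL2)).symm.toContinuousLinearMap h1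

theorem HasWeakDeriv.scatter {u v : NetworkL2 N} (h : ∀ k, HasWeakDeriv (u k) (v k))
    (k : Fin N) : HasWeakDeriv (scatter N u k) (scatter N v k) := by
  have h1 := ((HasWeakDeriv.sum Finset.univ fun i _ => h i).smul (2 / N : ℂ)).add
    ((h k).smul (-1))
  simpa [scatter_apply, sub_eq_add_neg] using h1

theorem coeFn_scatter {u : NetworkL2 N} {g : Fin N → ℝ → ℂ}
    (h : ∀ k, u k =ᵐ[branchMeasure] g k) (k : Fin N) :
    scatter N u k =ᵐ[branchMeasure] fun x => (2 / N : ℂ) * ∑ j, g j x - g k x := by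
  rw [scatter_apply]
  filter_upwards [Lp.coeFn_sub ((2 / N : ℂ) • ∑ j, u j) (u k),
    Lp.coeFn_smul (2 / N : ℂ) (∑ j, u j), coeFn_sum_branch Finset.univ (fun j => u j),
    ae_all_iff.2 h] with x h1 h2 h3 h4
  rw [h1, Pi.sub_apply, h2, Pi.smul_apply, h3, smul_eq_mul]
  simp only [h4]

/-- With a common vertex value `c`, scattering returns `(2/N) N c - c = c`; with zero total flux it
returns `-q_k'(0)`. These are the matching conditions of `symbol_mul_fourier_glue`. -/
theorem symbol_mul_fourier_unfold {f g : NetworkL2 N} (hf : SatisfiesKirchhoff f)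
    (hfg : ∀ k, ∃ v, HasWeakDeriv (f k) v ∧ HasWeakDeriv v (-g k)) (k : Fin N) :
    ∀ᵐ ξ, (symbol ξ : ℂ) * (𝓕 (unfold k f) : LineL2) ξ = (𝓕 (unfold k g) : LineL2) ξ := by
  have hN : (N : ℂ) ≠ 0 := Nat.cast_ne_zero.2 (NeZero.ne N)
  obtain ⟨q, hq, hqd, hq0, hqs⟩ := hf
  choose v hv1 hv2 using hfg
  have hS1 := HasWeakDeriv.scatter (u := f) (v := WithLp.toLp 2 v) hv1
  have hS2 := HasWeakDeriv.scatter (u := WithLp.toLp 2 v) (v := -g) hv2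
  have hqdiff : ∀ j, DifferentiableWithinAt ℝ (q j) (Ici 0) 0 := fun j =>
    (hqd j).differentiableOn (by simp) 0 self_mem_Ici
  have hcd : ContDiffOn ℝ 1 (fun x => (2 / N : ℂ) * ∑ j, q j x - q k x) (Ici 0) :=
    (contDiffOn_const.mul (ContDiffOn.sum fun j _ => hqd j)).sub (hqd k)
  have hder : derivWithin (fun x => (2 / N : ℂ) * ∑ j, q j x - q k x) (Ici 0) 0
      = -derivWithin (q k) (Ici 0) 0 := by
    have hd := ((HasDerivWithinAt.fun_sum (u := Finset.univ)
      fun j _ => (hqdiff j).hasDerivWithinAt).const_mul (2 / N : ℂ)).sub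
        (hqdiff k).hasDerivWithinAt
    rw [hqs, mul_zero, zero_sub] at hd
    exact hd.derivWithin (uniqueDiffOn_Ici 0 0 self_mem_Ici)
  have key := symbol_mul_fourier_glue (hv1 k) (hv2 k) (hqd k) (hq k) (hS1 k) (hS2 k) hcd
    (coeFn_scatter hq k) (by
      have : ∀ j, q j 0 = q k 0 := fun j => hq0 j k
      simp only [this, Finset.sum_const, Finset.card_univ, Fintype.card_fin, nsmul_eq_mul]
      field_simp
      ring) (by rw [hder, add_neg_cancel])
  have e : glue (-(-g k)) (-(scatter N (-g) k)) = unfold k g := by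
    rw [map_neg, PiLp.neg_apply, neg_neg, neg_neg, unfold_apply]
  rw [e] at key
  exact key

/-- The relation `P_k(-x) = (2/N) ∑_j P_j(x) - P_k(x)` extends by continuity to `x = 0`. Its value
there makes every `P_k(0)` the mean of all of them; its derivative there gives `∑_j P_j'(0) = 0`. -/
theorem satisfiesKirchhoff_of_unfold {f : NetworkL2 N} {P : Fin N → ℝ → ℂ}
    (hP : ∀ k, ContDiff ℝ 1 (P k)) (hf : ∀ k, unfold k f =ᵐ[volume] P k) :
    SatisfiesKirchhoff f := by
  have hN : (N : ℂ) ≠ 0 := Nat.cast_ne_zero.2 (NeZero.ne N)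
  have hfk : ∀ k, f k =ᵐ[branchMeasure] P k := by
    intro k
    rw [← restrictHalf_unfold k f]
    exact (coeFn_restrictHalf _).trans (ae_restrict_of_ae (hf k))
  have hae : ∀ k, ∀ᵐ x ∂branchMeasure, P k (-x) = (2 / N : ℂ) * ∑ j, P j x - P k x := by
    intro k
    have h1 : restrictHalf (reflect (unfold k f)) = scatter N f k := by
      rw [reflect_unfold, restrictHalf_unfold]
    filter_upwards [coeFn_scatter hfk k, coeFn_restrictHalf (reflect (unfold k f)),
      ae_restrict_of_ae (coeFn_reflect (unfold k f)), ae_restrict_of_ae (ae_comp_neg (hf k))]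
      with x h2 h3 h4 h5
    rw [← h2, ← h1, h3, h4, h5]
  have hall : ∀ k, EqOn (fun x => P k (-x)) (fun x => (2 / N : ℂ) * ∑ j, P j x - P k x)
      (Ici 0) := by
    intro k
    have hc1 : Continuous fun x => P k (-x) := (hP k).continuous.comp continuous_neg
    have hc2 : Continuous fun x => (2 / N : ℂ) * ∑ j, P j x - P k x :=
      (continuous_const.mul (continuous_finsetSum _ fun j _ => (hP j).continuous)).sub
        (hP k).continuous
    have h1 := Measure.eqOn_open_of_ae_eq (hae k) isOpen_Ioi hc1.continuousOn hc2.continuousOn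
    have h2 := h1.closure hc1 hc2
    rwa [closure_Ioi] at h2
  have hd : ∀ k, HasDerivAt (P k) (deriv (P k) 0) 0 := fun k =>
    ((hP k).differentiable (by simp) 0).hasDerivAt
  refine ⟨P, hfk, fun k => (hP k).contDiffOn, ?_, ?_⟩
  · have h0 : ∀ k, P k 0 = (1 / N : ℂ) * ∑ j, P j 0 := by
      intro k
      have := hall k self_mem_Ici
      simp only [neg_zero] at this
      linear_combination this / 2
    intro i k
    rw [h0 i, h0 k]
  · have hdw : ∀ k, derivWithin (P k) (Ici 0) 0 = deriv (P k) 0 := fun k =>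
      (hd k).hasDerivWithinAt.derivWithin (uniqueDiffOn_Ici 0 0 self_mem_Ici)
    simp only [hdw]
    -- Any one branch yields the flux condition, as `P_k'(0)` cancels from both sides.
    have k : Fin N := 0
    have e1 : HasDerivWithinAt (fun x => P k (-x)) (-deriv (P k) 0) (Ici 0) 0 := by
      have h1 : HasDerivAt (P k) (deriv (P k) 0) (-0) := by rw [neg_zero]; exact hd k
      have h2 := h1.scomp (0 : ℝ) (hasDerivAt_neg 0)
      rw [neg_one_smul] at h2
      exact h2.hasDerivWithinAt
    have e2 := (((HasDerivAt.fun_sum (u := Finset.univ) fun j _ => hd j).const_mul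
      (2 / N : ℂ)).sub (hd k)).hasDerivWithinAt (s := Ici 0)
    have e3 := e2.congr_of_mem (hall k) self_mem_Ici
    have e4 := (uniqueDiffOn_Ici (0 : ℝ) 0 self_mem_Ici).eq_deriv _ e1 e3
    have e5 : (2 / N : ℂ) * ∑ j, deriv (P j) 0 = 0 := by linear_combination -e4
    exact (mul_eq_zero.1 e5).resolve_left (div_ne_zero two_ne_zero hN)

theorem isUnitaryGroupOf_networkGroup (N : ℕ) [NeZero N] :
    IsUnitaryGroupOf (freeKirchhoff N) (networkGroup N) where
  map_add := networkGroupFun_add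
  continuous := continuous_networkGroup
  generator f g := by
    refine mem_graph_freeKirchhoff.trans (Iff.trans ?_ (hasDerivAt_networkGroup_iff f g).symm)
    constructor
    · rintro ⟨h1, h2⟩
      exact symbol_mul_fourier_unfold h1 h2
    · intro h
      choose h1 P hP hfP using fun k => exists_deriv_of_symbol_mul_fourier (h k)
      refine ⟨satisfiesKirchhoff_of_unfold hP hfP, fun k => ?_⟩
      obtain ⟨V, hV1, hV2⟩ := h1 k
      refine ⟨restrictHalf V, ?_, ?_⟩
      · have := hasWeakDeriv_restrictHalf hV1
        rwa [restrictHalf_unfold] at this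
      · have := hasWeakDeriv_restrictHalf hV2
        rwa [map_neg, restrictHalf_unfold] at this

/-! ### The dispersive estimate on the network -/

/-- The `3` counts `f_k` on the positive side, then `(2/N) ∑_j f_j` and `f_k` on the negative side;
`N ≥ 2` gives `2/N ≤ 1`, so the bound does not depend on `N`. -/
theorem eLpNorm_one_unfold_le (hN : 2 ≤ N) (f : NetworkL2 N) (k : Fin N) :
    eLpNorm (unfold k f) 1 volume ≤ 3 * l1Norm f := by
  have hk : eLpNorm (f k) 1 branchMeasure ≤ l1Norm f :=
    Finset.single_le_sum (f := fun k => eLpNorm (f k) 1 branchMeasure) (fun _ _ => zero_le)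
      (Finset.mem_univ k)
  have hS : eLpNorm (scatter N f k) 1 branchMeasure ≤ l1Norm f + l1Norm f := by
    rw [scatter_apply, eLpNorm_congr_ae (Lp.coeFn_sub _ _)]
    refine (eLpNorm_sub_le (Lp.aestronglyMeasurable _) (Lp.aestronglyMeasurable _) le_rfl).trans
      (add_le_add ?_ hk)
    rw [eLpNorm_congr_ae (Lp.coeFn_smul _ _), eLpNorm_const_smul]
    have hc : ‖(2 / N : ℂ)‖ₑ ≤ 1 := by
      rw [← ofReal_norm, norm_div, Complex.norm_natCast, Complex.norm_ofNat]
      refine ENNReal.ofReal_le_one.2 (div_le_one_of_le₀ (by exact_mod_cast hN) (by positivity))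
    exact (mul_le_of_le_one_left zero_le hc).trans (eLpNorm_one_sum_branch_le _ _)
  rw [unfold_apply]
  refine (eLpNorm_one_glue_le _ _).trans ((add_le_add hk hS).trans (le_of_eq ?_))
  ring

theorem l1ToLinftyNorm_networkGroup_le (hN : 2 ≤ N) {t : ℝ} (ht : t ≠ 0) :
    l1ToLinftyNorm (fun f => networkGroup N t f)
      ≤ ENNReal.ofReal (3 * |t| ^ (-(1 / 2) : ℝ)) := by
  refine sInf_le fun f hf => iSup_le fun k => ?_
  have h1 := eLpNorm_one_unfold_le hN f k
  have h2 : eLpNorm (unfold k f) 1 volume < ⊤ :=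
    h1.trans_lt (ENNReal.mul_lt_top (by norm_num) hf)
  rw [networkGroup_apply, eLpNorm_congr_ae (coeFn_restrictHalf _)]
  calc eLpNorm (lineGroup t (unfold k f)) ⊤ branchMeasure
      ≤ eLpNorm (lineGroup t (unfold k f)) ⊤ volume := eLpNorm_restrict_le _ _ _ _
    _ ≤ ENNReal.ofReal (|t| ^ (-(1 / 2) : ℝ)) * eLpNorm (unfold k f) 1 volume :=
      eLpNorm_top_lineGroup_le ht h2
    _ ≤ ENNReal.ofReal (|t| ^ (-(1 / 2) : ℝ)) * (3 * l1Norm f) := by gcongr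
    _ = ENNReal.ofReal (3 * |t| ^ (-(1 / 2) : ℝ)) * l1Norm f := by
      rw [ENNReal.ofReal_mul (by norm_num), ENNReal.ofReal_ofNat]
      ring

end

end StarNetwork

/-- The free Kirchhoff Laplacian `H₀` on the star network with `N ≥ 2` branches generates exactly
one unitary group `e^{itH₀}`, and this group satisfies the dispersive estimate. -/
theorem mainTheorem5 :
    ∃ C : ℝ, 0 < C ∧ ∀ N : ℕ, 2 ≤ N →
      (∃! U : ℝ → StarNetwork.NetworkL2 N ≃ₗᵢ[ℂ] StarNetwork.NetworkL2 N,
        StarNetwork.IsUnitaryGroupOf (StarNetwork.freeKirchhoff N) U) ∧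
      ∀ U : ℝ → StarNetwork.NetworkL2 N ≃ₗᵢ[ℂ] StarNetwork.NetworkL2 N,
        StarNetwork.IsUnitaryGroupOf (StarNetwork.freeKirchhoff N) U →
        ∀ t : ℝ, t ≠ 0 →
          StarNetwork.l1ToLinftyNorm (fun f => U t f) ≤
            ENNReal.ofReal (C * |t| ^ (-(1 / 2) : ℝ)) := by
  refine ⟨3, by norm_num, fun N hN => ?_⟩
  have : NeZero N := ⟨by omega⟩
  have hW := StarNetwork.isUnitaryGroupOf_networkGroup N
  refine ⟨⟨_, hW, fun U hU => hU.unique hW⟩, fun U hU t ht => ?_⟩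
  rw [hU.unique hW]
  exact StarNetwork.l1ToLinftyNorm_networkGroup_le hN ht
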